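/- Let $\mathbf k$ be a finite field, let $\mathfrak U \le \mathbf k^\times$ be a subgroup of its group of units, and let $R$ be a field of characteristic zero. Let $\mathrm{VIC}^{\mathfrak U}(\mathbf k)$ be the category whose objects are the finite-dimensional $\mathbf k$-vector spaces, each nonzero one equipped with a $\mathfrak U$-orientation, i.e. a generator of its top exterior power defined up to multiplication by $\mathfrak U$. A morphism $V \to W$ is a pair $(T, C)$, where $T : V \to W$ is an injective linear map and $C$ is a direct complement of $T(V)$ in $W$; if $\dim V = \dim W$, the isomorphism $T$ is required to respect the orientations. Composition is $(T, C)\circ(S, D) = (T\circ S,\, C \oplus T(D))$. A $\mathrm{VIC}^{\mathfrak U}(\mathbf k)$-module over $R$ is a functor $\mathcal A$ from this category to $R$-modules, and $\mathcal A_n$ denotes its value on $\mathbf k^n$ with the standard orientation. Let $H_0^{\mathrm{VIC}^{\mathfrak U}}$ be the right exact endofunctor of the category of such modules given by $$H_0^{\mathrm{VIC}^{\mathfrak U}}(\mathcal A)_V = \mathcal A_V \Big/ \big\langle f_*(\mathcal A_W) \;\big|\; f : W \to V,\ \dim W < \dim V \big\rangle,$$ and let $H_i^{\mathrm{VIC}^{\mathfrak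 U}}$ be its $i$-th left derived functor. Let $\mathcal A$ be a $\mathrm{VIC}^{\mathfrak U}(\mathbf k)$-module over $R$ and let $d, r$ be integers such that $H_0^{\mathrm{VIC}^{\mathfrak U}}(\mathcal A)_n = 0$ for all $n > d$ and $H_1^{\mathrm{VIC}^{\mathfrak U}}(\mathcal A)_n = 0$ for all $n > r$. Then for every $i \ge 2$ the group $H_i^{\mathrm{VIC}^{\mathfrak U}}(\mathcal A)_n$ vanishes for all $$n > 3^{i-1}\left(\max(r,d) + \tfrac12\right) - \tfrac12 .$$ -/

import Mathlib

open CategoryTheory CategoryTheory.Limits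

universe u v

/-- A `U`-orientation of a finite-dimensional `k`-vector space `V` (`U` a subgroup of the units
of `k`): a generator of the top exterior power of `V`, defined up to multiplication by `U`.
It is stored as the set of all the generators in its class. -/
@[ext]
structure UOrientation {k : Type u} [Field k] (U : Subgroup kˣ) (V : Type u) [AddCommGroup V]
    [Module k V] where
  /-- the class of generators, as a subset of the exterior algebra -/
  gens : Set (ExteriorAlgebra k V)
  /-- it is the `U`-orbit of one generator of the top exterior power -/
  exists_generator : ∃ ω : ExteriorAlgebra k V,
    Submodule.span k {ω} = ⋀[k]^(Module.finrank k V) V ∧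
      gens = {x | ∃ c ∈ U, x = (c : k) • ω}

/-- Objects of the category `VIC^U(k)`: finite-dimensional `k`-vector spaces such that the nonzero
ones are equipped with a `U`-orientation. -/
structure VICU {k : Type u} [Field k] (U : Subgroup kˣ) where
  carrier : Type u
  [addCommGroup : AddCommGroup carrier]
  [module : Module k carrier]
  [finite : Module.Finite k carrier]
  orient : Nontrivial carrier → UOrientation U carrier

namespace VICU

variable {k : Type u} [Field k] {U : Subgroup kˣ}

instance : CoeSort (VICU U) (Type u) := ⟨VICU.carrier⟩

attribute [instance] VICU.addCommGroup VICU.module VICU.finite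

/-- The rank (dimension) of an object. -/
noncomputable def rank (V : VICU U) : ℕ := Module.finrank k V

/-- Morphisms of `VIC^U(k)`: an injective linear map together with a chosen direct complement of
its image. If source and target have the same rank (so that the map is an isomorphism and the
complement is zero), the map has to respect the orientations. -/
@[ext]
structure Hom (V W : VICU U) where
  toLin : V →ₗ[k] W
  compl : Submodule k W
  injective : Function.Injective toLin
  isCompl : IsCompl (LinearMap.range toLin) compl
  map_orient : V.rank = W.rank → ∀ (hV : Nontrivial V) (hW : Nontrivial W),
    ExteriorAlgebra.map toLin '' (V.orient hV).gens = (W.orient hW).gens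

theorem Hom.rank_le {V W : VICU U} (f : Hom V W) : V.rank ≤ W.rank :=
  LinearMap.finrank_le_finrank_of_injective f.injective

/-- The identity morphism `(id, 0)`. -/
def Hom.id (V : VICU U) : Hom V V where
  toLin := LinearMap.id
  compl := ⊥
  injective := Function.injective_id
  isCompl := by rw [LinearMap.range_id]; exact isCompl_top_bot
  map_orient _ _ _ := by rw [ExteriorAlgebra.map_id]; simp

/-- Composition `(T, C) ∘ (S, D) = (T ∘ S, C ⊕ T(D))`. -/
def Hom.comp {V W X : VICU U} (f : Hom V W) (g : Hom W X) : Hom V X where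
  toLin := g.toLin ∘ₗ f.toLin
  compl := g.compl ⊔ f.compl.map g.toLin
  injective := g.injective.comp f.injective
  isCompl := by
    have h1 : (LinearMap.range f.toLin).map g.toLin ⊔ f.compl.map g.toLin
        = LinearMap.range g.toLin := by
      rw [← Submodule.map_sup, f.isCompl.sup_eq_top, LinearMap.range_eq_map]
    rw [LinearMap.range_comp, sup_comm]
    constructor
    · refine Disjoint.disjoint_sup_right_of_disjoint_sup_left ?_ ?_
      · exact (Submodule.disjoint_map g.injective f.isCompl.disjoint)
      · rw [h1]; exact g.isCompl.disjoint
    · rw [codisjoint_iff, ← sup_assoc, h1, g.isCompl.sup_eq_top]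
  map_orient h hV hX := by
    have h1 := f.rank_le
    have h2 := g.rank_le
    have hW : Nontrivial W := f.injective.nontrivial
    rw [← g.map_orient (by omega) hW hX, ← f.map_orient (by omega) hV hW,
      ← ExteriorAlgebra.map_comp_map, Set.image_image]
    rfl

/-- The category `VIC^U(k)`. -/
instance : Category.{u} (VICU U) where
  Hom := Hom
  id := Hom.id
  comp := Hom.comp
  id_comp f := by
    refine Hom.ext rfl ?_
    change f.compl ⊔ (⊥ : Submodule k _).map f.toLin = f.compl
    simp
  comp_id f := by
    refine Hom.ext rfl ?_
    change ⊥ ⊔ f.compl.map LinearMap.id = f.compl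
    simp
  assoc f g h := by
    refine Hom.ext rfl ?_
    change h.compl ⊔ (g.compl ⊔ f.compl.map g.toLin).map h.toLin
      = (h.compl ⊔ g.compl.map h.toLin) ⊔ f.compl.map (h.toLin ∘ₗ g.toLin)
    rw [Submodule.map_sup, Submodule.map_comp, sup_assoc]

/-- The exterior product of a basis generates the top exterior power. -/
theorem span_ιMulti_basis {V : Type u} [AddCommGroup V] [Module k V] {n : ℕ}
    (b : Module.Basis (Fin n) k V) :
    Submodule.span k {ExteriorAlgebra.ιMulti k n b} = ⋀[k]^(Module.finrank k V) V := by
  have hn : Module.finrank k V = n := by simp [Module.finrank_eq_card_basis b]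
  rw [hn, ← ExteriorAlgebra.ιMulti_span_fixedDegree]
  apply le_antisymm
  · exact Submodule.span_mono (by rintro _ rfl; exact ⟨_, rfl⟩)
  · rw [Submodule.span_le]
    rintro _ ⟨w, rfl⟩
    have h : ExteriorAlgebra.ιMulti k n = (LinearMap.toSpanSingleton k (ExteriorAlgebra k V)
        (ExteriorAlgebra.ιMulti k n b)).compAlternatingMap b.det := by
      refine Module.Basis.ext_alternating b fun f hf => ?_
      let σ : Equiv.Perm (Fin n) := Equiv.ofBijective f (Finite.injective_iff_bijective.1 hf)
      change ExteriorAlgebra.ιMulti k n (b ∘ σ) = b.det (b ∘ σ) • ExteriorAlgebra.ιMulti k n b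
      rw [AlternatingMap.map_perm, AlternatingMap.map_perm, b.det_self]
      rcases Int.units_eq_one_or (Equiv.Perm.sign σ) with hs | hs <;> simp [hs]
    exact Submodule.mem_span_singleton.2 ⟨b.det w, (congrArg (fun t => t w) h).symm⟩

/-- The orientation given by the exterior product of a basis. -/
noncomputable def orientOfBasis (U : Subgroup kˣ) {V : Type u} [AddCommGroup V] [Module k V]
    {n : ℕ} (b : Module.Basis (Fin n) k V) : UOrientation U V where
  gens := {x | ∃ c ∈ U, x = (c : k) • ExteriorAlgebra.ιMulti k n b}
  exists_generator := ⟨_, span_ιMulti_basis b, rfl⟩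

/-- The object `k^n` with its standard orientation `e_1 ∧ ⋯ ∧ e_n`. -/
noncomputable def std (U : Subgroup kˣ) (n : ℕ) : VICU U where
  carrier := Fin n → k
  orient _ := orientOfBasis U (Pi.basisFun k (Fin n))

/-- A linear equivalence that respects orientations is an isomorphism of `VIC^U(k)`. -/
def isoOfLinearEquiv {V W : VICU U} (e : V ≃ₗ[k] W)
    (he : ∀ (hV : Nontrivial V) (hW : Nontrivial W),
      ExteriorAlgebra.map (e : V →ₗ[k] W) '' (V.orient hV).gens = (W.orient hW).gens) :
    V ≅ W where
  hom := Hom.mk (e : V →ₗ[k] W) ⊥ e.injective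
    (by rw [LinearEquiv.range]; exact isCompl_top_bot) (fun _ => he)
  inv := Hom.mk (e.symm : W →ₗ[k] V) ⊥ e.symm.injective
    (by rw [LinearEquiv.range]; exact isCompl_top_bot) (fun _ hW hV => by
      rw [← he hV hW, ← Set.image_comp, ← AlgHom.coe_comp, ExteriorAlgebra.map_comp_map]
      simp [ExteriorAlgebra.map_id])
  hom_inv_id := by
    refine Hom.ext ?_ ?_
    · change (e.symm : W →ₗ[k] V) ∘ₗ (e : V →ₗ[k] W) = LinearMap.id
      simp
    · change (⊥ : Submodule k V) ⊔ (⊥ : Submodule k W).map (e.symm : W →ₗ[k] V) = ⊥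
      simp
  inv_hom_id := by
    refine Hom.ext ?_ ?_
    · change (e : V →ₗ[k] W) ∘ₗ (e.symm : W →ₗ[k] V) = LinearMap.id
      simp
    · change (⊥ : Submodule k W) ⊔ (⊥ : Submodule k V).map (e : V →ₗ[k] W) = ⊥
      simp

/-- Every object is isomorphic to some standard object `k^n`. -/
theorem exists_iso_std (V : VICU U) : ∃ n : ℕ, Nonempty (std U n ≅ V) := by
  refine ⟨Module.finrank k V, ?_⟩
  set n := Module.finrank k V with hn
  let b : Module.Basis (Fin n) k V := Module.finBasis k V
  by_cases hV : Nontrivial V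
  · obtain ⟨ω, hω, hg⟩ := (V.orient hV).exists_generator
    have hpos : 0 < n := Module.finrank_pos
    have h0 : ω ∈ Submodule.span k {ExteriorAlgebra.ιMulti k n b} := by
      rw [span_ιMulti_basis b, ← hω]; exact Submodule.mem_span_singleton_self ω
    obtain ⟨c, hc⟩ := Submodule.mem_span_singleton.1 h0
    have hb : ExteriorAlgebra.ιMulti k n b ∈ Submodule.span k {ω} := by
      rw [hω, ← span_ιMulti_basis b]; exact Submodule.mem_span_singleton_self _
    have hbne : ExteriorAlgebra.ιMulti k n b ≠ 0 := by
      intro h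
      have h1 := exteriorPower.finrank_eq (R := k) (M := V) n
      rw [← hn, Nat.choose_self] at h1
      have h2 := span_ιMulti_basis b
      rw [h, Submodule.span_zero_singleton, ← hn] at h2
      rw [← h2] at h1
      simp at h1
    have hc0 : c ≠ 0 := by
      rintro rfl
      rw [zero_smul] at hc
      rw [← hc, Submodule.span_zero_singleton] at hb
      exact hbne ((Submodule.mem_bot k).1 hb)
    let w : Fin n → kˣ := Function.update 1 ⟨0, hpos⟩ (Units.mk0 c hc0)
    let b' := b.unitsSMul w
    have hb' : ExteriorAlgebra.ιMulti k n b' = ω := by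
      have h1 : (b' : Fin n → V) = fun i => ((w i : kˣ) : k) • b i := by
        funext i; rw [Module.Basis.unitsSMul_apply]; rfl
      rw [h1, (ExteriorAlgebra.ιMulti k n).map_smul_univ (fun i => ((w i : kˣ) : k)) b, ← hc]
      congr 1
      rw [← Units.coe_prod, Finset.prod_update_of_mem (Finset.mem_univ _)]
      simp
    refine ⟨isoOfLinearEquiv (V := std U n) (W := V) b'.equivFun.symm ?_⟩
    intro h h'
    have hmap : ExteriorAlgebra.map (b'.equivFun.symm : (Fin n → k) →ₗ[k] V)
        (ExteriorAlgebra.ιMulti k n (Pi.basisFun k (Fin n))) = ω := by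
      rw [ExteriorAlgebra.map_apply_ιMulti, ← hb']
      congr 1
      funext i
      simp
    rw [hg]
    change (ExteriorAlgebra.map (b'.equivFun.symm : (Fin n → k) →ₗ[k] V)) ''
      {x | ∃ c ∈ U, x = (c : k) • ExteriorAlgebra.ιMulti k n (Pi.basisFun k (Fin n))} = _
    ext x
    constructor
    · rintro ⟨_, ⟨a, ha, rfl⟩, rfl⟩
      exact ⟨a, ha, by rw [map_smul, hmap]⟩
    · rintro ⟨a, ha, rfl⟩
      exact ⟨_, ⟨a, ha, rfl⟩, by rw [map_smul, hmap]⟩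
  · exact ⟨isoOfLinearEquiv (V := std U n) (W := V) b.equivFun.symm
      (fun _ h => absurd h hV)⟩

/-- Functors into an abelian category with enough projectives and colimits again have enough
projectives, if every object of the source is isomorphic to one of a sequence of objects. -/
theorem enoughProjectives_functor {C : Type*} [Category.{u} C] (X : ℕ → C)
    (hX : ∀ c : C, ∃ n, Nonempty (X n ≅ c)) (D : Type*) [Category D] [Abelian D]
    [EnoughProjectives D] [HasColimitsOfSize.{0, u} D] : EnoughProjectives (C ⥤ D) := by
  let L : Discrete ℕ ⥤ C := Discrete.functor X
  have hpe : ((Functor.whiskeringLeft (Discrete ℕ) C D).obj L).PreservesEpimorphisms :=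
    ⟨fun f hf => by
      rw [NatTrans.epi_iff_epi_app] at hf ⊢
      exact fun n => hf (L.obj n)⟩
  refine ⟨fun A => ?_⟩
  let B : Discrete ℕ ⥤ D := Discrete.functor (fun n => Projective.over (A.obj (X n)))
  let p : B ⟶ L ⋙ A := Discrete.natTrans (fun n => Projective.π (A.obj (X n.as)))
  have hB : Projective B := by
    refine ⟨fun {E Y} f e he => ?_⟩
    rw [NatTrans.epi_iff_epi_app] at he
    have hP : ∀ n, Projective (B.obj n) := fun n =>
      inferInstanceAs (Projective (Projective.over (A.obj (X n.as))))
    refine ⟨Discrete.natTrans (fun n => Projective.factorThru (f.app n) (e.app n)), ?_⟩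
    ext n
    simp
  let adj := L.lanAdjunction D
  let q : L.lan.obj B ⟶ A := (adj.homEquiv B A).symm p
  have hq : p = adj.unit.app B ≫ ((Functor.whiskeringLeft (Discrete ℕ) C D).obj L).map q :=
    ((adj.homEquiv B A).apply_symm_apply p).symm.trans (adj.homEquiv_unit (X := B) (Y := A) (f := q))
  have hqe : ∀ n, Epi (q.app (X n)) := fun n => by
    have h1 : (adj.unit.app B).app ⟨n⟩ ≫ q.app (X n) = p.app ⟨n⟩ := by rw [hq]; rfl
    have h2 : Epi (p.app ⟨n⟩) := inferInstanceAs (Epi (Projective.π (A.obj (X n))))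
    rw [← h1] at h2
    exact epi_of_epi ((adj.unit.app B).app ⟨n⟩) (q.app (X n))
  have hqE : Epi q := by
    rw [NatTrans.epi_iff_epi_app]
    intro c
    obtain ⟨n, ⟨e⟩⟩ := hX c
    have h1 := q.naturality e.hom
    have h2 := hqe n
    have h3 : Epi ((L.lan.obj B).map e.hom ≫ q.app c) := by
      rw [h1]; exact epi_comp _ _
    exact epi_of_epi ((L.lan.obj B).map e.hom) (q.app c)
  exact ⟨{ p := L.lan.obj B, projective := adj.map_projective B hB, f := q, epi := hqE }⟩

/-- There are enough projective `VIC^U(k)`-modules over `R`. -/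
instance (R : Type v) [CommRing R] : EnoughProjectives (VICU U ⥤ ModuleCat.{max u v} R) :=
  enoughProjectives_functor (std U) exists_iso_std _

variable {R : Type v} [CommRing R]

/-- The submodule of `A_V` generated by the images of all `f_* : A_W → A_V` for morphisms
`f : W → V` with `dim W < dim V`. -/
def lowerSpan (A : VICU U ⥤ ModuleCat.{max u v} R) (V : VICU U) : Submodule R (A.obj V) :=
  ⨆ (W : VICU U) (f : W ⟶ V) (_ : W.rank < V.rank), LinearMap.range (A.map f).hom

theorem lowerSpan_le_comap (A : VICU U ⥤ ModuleCat.{max u v} R) {V V' : VICU U} (g : V ⟶ V') :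
    lowerSpan A V ≤ (lowerSpan A V').comap (A.map g).hom := by
  refine iSup_le fun W => iSup_le fun f => iSup_le fun h => ?_
  rintro _ ⟨x, rfl⟩
  have h' : W.rank < V'.rank := lt_of_lt_of_le h (Hom.rank_le g)
  refine Submodule.mem_iSup_of_mem W (Submodule.mem_iSup_of_mem (f ≫ g)
    (Submodule.mem_iSup_of_mem h' ⟨x, ?_⟩))
  simp

theorem lowerSpan_le_comap_app {A B : VICU U ⥤ ModuleCat.{max u v} R} (φ : A ⟶ B) (V : VICU U) :
    lowerSpan A V ≤ (lowerSpan B V).comap (φ.app V).hom := by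
  refine iSup_le fun W => iSup_le fun f => iSup_le fun h => ?_
  rintro _ ⟨x, rfl⟩
  refine Submodule.mem_iSup_of_mem W (Submodule.mem_iSup_of_mem f
    (Submodule.mem_iSup_of_mem h ⟨(φ.app W).hom x, ?_⟩))
  exact (congrArg (fun t => t.hom x) (φ.naturality f)).symm

/-- `H_0(A)`, with `H_0(A)_V = A_V / ⟨f_*(A_W) | f : W → V, dim W < dim V⟩`. -/
def H0obj (A : VICU U ⥤ ModuleCat.{max u v} R) : VICU U ⥤ ModuleCat.{max u v} R where
  obj V := ModuleCat.of R (A.obj V ⧸ lowerSpan A V)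
  map g := ModuleCat.ofHom (Submodule.mapQ _ _ (A.map g).hom (lowerSpan_le_comap A g))
  map_id V := by
    ext x
    simp
  map_comp f g := by
    ext x
    simp

variable (U R)

/-- The functor `H_0` from `VIC^U(k)`-modules over `R` to `VIC^U(k)`-modules over `R`. -/
def H0 : (VICU U ⥤ ModuleCat.{max u v} R) ⥤ (VICU U ⥤ ModuleCat.{max u v} R) where
  obj A := H0obj A
  map φ :=
    { app V := ModuleCat.ofHom (Submodule.mapQ _ _ (φ.app V).hom (lowerSpan_le_comap_app φ V))
      naturality V W f := by
        refine ModuleCat.hom_ext (Submodule.linearMap_qext _ (LinearMap.ext fun x => ?_))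
        have h := congrArg (fun t => t.hom x) (φ.naturality f)
        exact congrArg (Submodule.Quotient.mk (p := lowerSpan _ W)) h }
  map_id A := by
    refine NatTrans.ext (funext fun V => ModuleCat.hom_ext
      (Submodule.linearMap_qext _ (LinearMap.ext fun x => ?_)))
    rfl
  map_comp φ ψ := by
    refine NatTrans.ext (funext fun V => ModuleCat.hom_ext
      (Submodule.linearMap_qext _ (LinearMap.ext fun x => ?_)))
    rfl

instance : (H0 U R).Additive where
  map_add := by
    intros
    refine NatTrans.ext (funext fun V => ModuleCat.hom_ext
      (Submodule.linearMap_qext _ (LinearMap.ext fun x => ?_)))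
    rfl

/-- `VIC^U(k)`-homology: the `i`-th left derived functor of `H_0`. -/
noncomputable def homology (i : ℕ) :
    (VICU U ⥤ ModuleCat.{max u v} R) ⥤ (VICU U ⥤ ModuleCat.{max u v} R) :=
  (H0 U R).leftDerived i

end VICU

/-! Put N = max(r, d), assumed nonnegative; otherwise `A` is zero. Cover `A` by a free module on
objects of rank at most N. The vanishing of H_1 above N says that the kernel of this cover is
generated in ranks at most N, and it embeds in a free module of the same kind. Dimension shifting
then reduces everything to bounding, step by step, the generation degrees of successive syzygies.

The engine is `lowerSpan_eq_top_of_kernel`: the kernel K of a map P → P' of free modules on objects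
of rank at most N is generated in ranks at most 3N + 1. Since N + 1/2 becomes 3(N + 1/2) under N ↦
3N + 1, iteration gives the stated bound.

To prove it, let dim V ≥ 3N + 2. The value P_V is a permutation module of the finite group Aut(V),
and R has characteristic zero, so membership in an invariant submodule of K_V can be tested after
averaging over the stabilizer of each generator p : Y_j → V (`mem_of_avg_mem`). Factor p through a
hyperplane H with a complementary line. Averages over Stab(p) see only the orbits of Stab(p) on
generators, and these are stable under H → V: every orbit of P_V meets the image of P_H
(`exists_aut_comp_eq_comp_incKer`), and distinct orbits on generators of P'_H stay distinct in P'_V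
(`exists_aut_kerObj`). A diagram chase then shows that the average of an element of K_V comes from
K_H. Orbit stability itself is linear algebra: products of transvections act transitively on the
pairs (vector, form) that split off a line compatible with two given morphisms
(`PairRel.of_finrank`). -/

namespace CategoryTheory

/-! ### Dimension shifting by splicing projective resolutions. -/

section Splice

variable {C : Type*} [Category C] [Abelian C] {S : ShortComplex C}

theorem ProjectiveResolution.exact_d_f_zero {X : C} (Q : ProjectiveResolution X) :
    (ShortComplex.mk _ _ Q.complex_d_comp_π_f_zero).Exact :=
  ShortComplex.exact_of_g_is_cokernel _ Q.isColimitCokernelCofork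

/-- The composite of the augmentation of a resolution of `S.X₁` with `S.f`. -/
noncomputable def ProjectiveResolution.spliceMap (Q : ProjectiveResolution S.X₁) :
    Q.complex.X 0 ⟶ S.X₂ :=
  (show Q.complex.X 0 ⟶ S.X₁ from Q.π.f 0) ≫ S.f

theorem ProjectiveResolution.d_comp_spliceMap (Q : ProjectiveResolution S.X₁) :
    Q.complex.d 1 0 ≫ Q.spliceMap = 0 := by
  have h : Q.complex.d 1 0 ≫ (show Q.complex.X 0 ⟶ S.X₁ from Q.π.f 0) = 0 :=
    Q.complex_d_comp_π_f_zero
  rw [spliceMap, ← Category.assoc, h, zero_comp]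

theorem ProjectiveResolution.spliceMap_comp (Q : ProjectiveResolution S.X₁) :
    Q.spliceMap ≫ S.g = 0 := by
  rw [spliceMap, Category.assoc, S.zero, comp_zero]

theorem ProjectiveResolution.exact_d_spliceMap (hS : S.ShortExact)
    (Q : ProjectiveResolution S.X₁) :
    (ShortComplex.mk _ _ Q.d_comp_spliceMap).Exact := by
  have := hS.mono_f
  let φ : ShortComplex.mk _ _ Q.complex_d_comp_π_f_zero ⟶ ShortComplex.mk _ _ Q.d_comp_spliceMap :=
    { τ₁ := 𝟙 _, τ₂ := 𝟙 _, τ₃ := S.f, comm₁₂ := by simp, comm₂₃ := Category.id_comp _ }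
  have : Epi φ.τ₁ := inferInstanceAs (Epi (𝟙 _))
  have : IsIso φ.τ₂ := inferInstanceAs (IsIso (𝟙 _))
  have : Mono φ.τ₃ := inferInstanceAs (Mono S.f)
  exact (ShortComplex.exact_iff_of_epi_of_isIso_of_mono φ).1 Q.exact_d_f_zero

theorem ProjectiveResolution.exact_spliceMap (hS : S.ShortExact)
    (Q : ProjectiveResolution S.X₁) :
    (ShortComplex.mk _ _ Q.spliceMap_comp).Exact := by
  let φ : ShortComplex.mk _ _ Q.spliceMap_comp ⟶ S :=
    { τ₁ := Q.π.f 0, τ₂ := 𝟙 _, τ₃ := 𝟙 _, comm₁₂ := (Category.comp_id _).symm, comm₂₃ := by simp }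
  have : Epi φ.τ₁ := inferInstanceAs (Epi (Q.π.f 0))
  have : IsIso φ.τ₂ := inferInstanceAs (IsIso (𝟙 _))
  have : Mono φ.τ₃ := inferInstanceAs (Mono (𝟙 _))
  exact (ShortComplex.exact_iff_of_epi_of_isIso_of_mono φ).2 hS.exact

/-- Splicing a projective resolution of `S.X₁` with a short exact sequence whose middle term is
projective. -/
noncomputable def ProjectiveResolution.splice (hS : S.ShortExact) [Projective S.X₂]
    (Q : ProjectiveResolution S.X₁) : ProjectiveResolution S.X₃ where
  complex := Q.complex.augment Q.spliceMap Q.d_comp_spliceMap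
  projective
    | 0 => inferInstanceAs (Projective S.X₂)
    | n + 1 => Q.projective n
  π := (ChainComplex.toSingle₀Equiv _ _).symm ⟨S.g, Q.spliceMap_comp⟩
  quasiIso := ⟨fun n => by
    have hg := hS.epi_g
    cases n with
    | zero =>
      rw [ChainComplex.quasiIsoAt₀_iff, ShortComplex.quasiIso_iff_of_zeros']
      · refine (ShortComplex.exact_and_epi_g_iff_of_iso ?_).2 ⟨Q.exact_spliceMap hS, hg⟩
        exact ShortComplex.isoMk (Iso.refl _) (Iso.refl _) (Iso.refl _)
          ((Category.id_comp _).trans (Category.comp_id _).symm)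
          (by
            have hπ := ChainComplex.toSingle₀Equiv_symm_apply_f_zero
              (C := Q.complex.augment Q.spliceMap Q.d_comp_spliceMap) S.g Q.spliceMap_comp
            refine (Category.id_comp _).trans (Eq.trans ?_ (Category.comp_id _).symm)
            exact hπ.symm)
      all_goals rfl
    | succ n =>
      rw [quasiIsoAt_iff_exactAt']
      · rw [HomologicalComplex.exactAt_iff' _ (n + 2) (n + 1) n (by simp) (by simp)]
        cases n with
        | zero => exact Q.exact_d_spliceMap hS
        | succ n => exact Q.exact_succ n
      · apply ChainComplex.exactAt_succ_single_obj⟩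

variable {D : Type*} [Category D] [Abelian D] [HasProjectiveResolutions C]
  (F : C ⥤ D) [F.Additive]

/-- Meant for `G` the evaluation at one object: it is exact, so it commutes with homology and
vanishing can be tested at that object alone, on any chosen resolution. -/
theorem leftDerived_isZero_iff {X : C} (Q : ProjectiveResolution X) (n : ℕ) {E : Type*}
    [Category E] [Abelian E] (G : D ⥤ E) [G.Additive] [G.PreservesHomology] :
    IsZero (G.obj ((F.leftDerived (n + 1)).obj X)) ↔
      (((ShortComplex.mk _ _ (Q.complex.d_comp_d (n + 2) (n + 1) n)).map F).map G).Exact := by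
  rw [ShortComplex.exact_iff_isZero_homology]
  let T := (ShortComplex.mk _ _ (Q.complex.d_comp_d (n + 2) (n + 1) n)).map F
  let e : (F.leftDerived (n + 1)).obj X ≅ T.homology :=
    Q.isoLeftDerivedObj F (n + 1) ≪≫
      ShortComplex.homologyMapIso (((F.mapHomologicalComplex _).obj Q.complex).isoSc' (n + 2)
        (n + 1) n (by simp) (by simp))
  exact (G.mapIso e ≪≫ (T.mapHomologyIso G).symm).isZero_iff

theorem leftDerived_succ_isZero_iff (hS : S.ShortExact) [Projective S.X₂] (n : ℕ) {E : Type*}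
    [Category E] [Abelian E] (G : D ⥤ E) [G.Additive] [G.PreservesHomology] :
    IsZero (G.obj ((F.leftDerived (n + 2)).obj S.X₃)) ↔
      IsZero (G.obj ((F.leftDerived (n + 1)).obj S.X₁)) := by
  let Q := projectiveResolution S.X₁
  rw [leftDerived_isZero_iff F (Q.splice hS) (n + 1) G, leftDerived_isZero_iff F Q n G]
  -- Splicing only shifts indices by one, so both sides speak of the same short complex.
  exact Iff.rfl

theorem leftDerived_one_isZero_iff (hS : S.ShortExact) [Projective S.X₂]
    (Q : ProjectiveResolution S.X₁) {E : Type*}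
    [Category E] [Abelian E] (G : D ⥤ E) [G.Additive] [G.PreservesHomology] :
    IsZero (G.obj ((F.leftDerived 1).obj S.X₃)) ↔
      (((ShortComplex.mk _ _ Q.d_comp_spliceMap).map F).map G).Exact :=
  leftDerived_isZero_iff F (Q.splice hS) 0 G

end Splice

end CategoryTheory

/-! ### Transitivity of transvections on pairs of a vector and a linear form. -/

section Transvections

variable {k V : Type*} [Field k] [AddCommGroup V] [Module k V] {K I : Submodule k V}

/-- Two pairs of a vector and a linear form are related by an automorphism of determinant one
that fixes `I` pointwise and is the identity modulo `K`. -/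
def PairRel (K I : Submodule k V) (p q : V × Module.Dual k V) : Prop :=
  ∃ u : V ≃ₗ[k] V, LinearEquiv.det u = 1 ∧ (∀ x ∈ I, u x = x) ∧ (∀ x, u x - x ∈ K) ∧
    u p.1 = q.1 ∧ ∀ x, q.2 (u x) = p.2 x

theorem PairRel.symm {p q : V × Module.Dual k V} (h : PairRel K I p q) : PairRel K I q p := by
  obtain ⟨u, h1, h2, h3, h4, h5⟩ := h
  refine ⟨u.symm, by rw [← inv_eq_one, ← map_inv] at h1; exact h1,
    fun x hx => by rw [LinearEquiv.symm_apply_eq, h2 x hx], fun x => ?_,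
    by rw [LinearEquiv.symm_apply_eq, h4], fun x => by simp [← h5]⟩
  have := K.neg_mem (h3 (u.symm x))
  simpa using this

theorem PairRel.trans {p q r : V × Module.Dual k V} (h : PairRel K I p q)
    (h' : PairRel K I q r) : PairRel K I p r := by
  obtain ⟨u, h1, h2, h3, h4, h5⟩ := h
  obtain ⟨u', h1', h2', h3', h4', h5'⟩ := h'
  refine ⟨u.trans u', by rw [LinearEquiv.det_trans, h1, h1', one_mul],
    fun x hx => by simp [h2 x hx, h2' x hx], fun x => ?_, by simp [h4, h4'],
    fun x => by simp [h5, h5']⟩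
  have := K.add_mem (h3' (u x)) (h3 x)
  simpa using this

/-- The transvection x ↦ x + (a - b)(x) l does it; it fixes l because a and b agree there. -/
theorem PairRel.of_fst {l : V} {a b : Module.Dual k V} (hl : l ∈ K) (ha : ∀ x ∈ I, a x = 0)
    (hb : ∀ x ∈ I, b x = 0) (hal : a l = 1) (hbl : b l = 1) : PairRel K I (l, a) (l, b) := by
  have h : (a - b) l = 0 := by simp [hal, hbl]
  refine ⟨LinearEquiv.transvection h, LinearEquiv.transvection.det_eq_one h, fun x hx => ?_,
    fun x => ?_, ?_, fun x => ?_⟩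
  · simp [LinearMap.transvection.apply, ha x hx, hb x hx]
  · simpa [LinearMap.transvection.apply] using K.smul_mem _ hl
  · simp [LinearMap.transvection.apply, hal, hbl]
  · simp [LinearMap.transvection.apply, hbl]

/-- The transvection x ↦ x + a(x)(m - l) does it; it preserves a because a(m - l) = 0. -/
theorem PairRel.of_snd {l m : V} {a : Module.Dual k V} (hl : l ∈ K) (hm : m ∈ K)
    (ha : ∀ x ∈ I, a x = 0) (hal : a l = 1) (ham : a m = 1) : PairRel K I (l, a) (m, a) := by
  have h : a (m - l) = 0 := by simp [hal, ham]
  refine ⟨LinearEquiv.transvection h, LinearEquiv.transvection.det_eq_one h, fun x hx => ?_,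
    fun x => ?_, ?_, fun x => ?_⟩
  · simp [LinearMap.transvection.apply, ha x hx]
  · simpa [LinearMap.transvection.apply] using K.smul_mem _ (K.sub_mem hm hl)
  · simp [LinearMap.transvection.apply, hal]
  · simp [LinearMap.transvection.apply, hal, ham]

theorem exists_dual_eq_one {p : Submodule k V} {l : V} (hl : l ∉ p) :
    ∃ a : Module.Dual k V, a l = 1 ∧ ∀ x ∈ p, a x = 0 := by
  obtain ⟨f, hf, hp⟩ := Submodule.exists_le_ker_of_notMem hl
  exact ⟨(f l)⁻¹ • f, by simp [hf], fun x hx => by simp [LinearMap.mem_ker.1 (hp hx)]⟩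

/-- Independence of l from m modulo I provides a form e vanishing on I with e l = e m = 1, and the
chain is (l, a), (l, e), (m, e), (m, b). -/
theorem PairRel.of_notMem {l m : V} {a b : Module.Dual k V} (hl : l ∈ K) (hm : m ∈ K)
    (ha : ∀ x ∈ I, a x = 0) (hb : ∀ x ∈ I, b x = 0) (hal : a l = 1) (hbm : b m = 1)
    (h : l ∉ I ⊔ Submodule.span k {m}) : PairRel K I (l, a) (m, b) := by
  obtain ⟨c, hc, hc'⟩ := exists_dual_eq_one h
  have hcm : c m = 0 := hc' m (Submodule.mem_sup_right (Submodule.mem_span_singleton_self m))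
  have hcI : ∀ x ∈ I, c x = 0 := fun x hx => hc' x (Submodule.mem_sup_left hx)
  let e : Module.Dual k V := b + (1 - b l) • c
  have heI : ∀ x ∈ I, e x = 0 := fun x hx => by simp [e, hb x hx, hcI x hx]
  have hel : e l = 1 := by simp [e, hc]
  have hem : e m = 1 := by simp [e, hbm, hcm]
  exact ((PairRel.of_fst hl ha heI hal hel).trans (PairRel.of_snd hl hm heI hel hem)).trans
    (PairRel.of_fst hm heI hb hem hbm)

/-- The transvections `1 + a ⊗ w` with `w ∈ K`, `a` vanishing on `I` and `a w = 0` generate a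
group that acts transitively on pairs `(l, a)` with `l ∈ K`, `a` vanishing on `I` and `a l = 1`. -/
theorem PairRel.of_finrank [FiniteDimensional k V]
    (hK : Module.finrank k ↥(K ⊓ I) + 2 ≤ Module.finrank k K) {l m : V} {a b : Module.Dual k V}
    (hl : l ∈ K) (hm : m ∈ K) (ha : ∀ x ∈ I, a x = 0) (hb : ∀ x ∈ I, b x = 0) (hal : a l = 1)
    (hbm : b m = 1) : PairRel K I (l, a) (m, b) := by
  by_cases h : l ∈ I ⊔ Submodule.span k {m}
  · have hn : ¬ K ≤ I ⊔ Submodule.span k {m} := fun hle => by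
      have h1 : K ≤ (K ⊓ I) ⊔ Submodule.span k {m} := by
        intro x hx
        obtain ⟨y, hy, z, hz, rfl⟩ := Submodule.mem_sup.1 (hle hx)
        have hzK : z ∈ K := (Submodule.span_singleton_le_iff_mem m K).2 hm hz
        have hyK : y ∈ K := by simpa using K.sub_mem hx hzK
        exact Submodule.add_mem_sup ⟨hyK, hy⟩ hz
      have h2 := Submodule.finrank_mono h1
      have h3 := Submodule.finrank_add_le_finrank_add_finrank (K ⊓ I) (Submodule.span k {m})
      have h4 := finrank_span_singleton (K := k) (v := m) (by rintro rfl; simp at hbm)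
      omega
    obtain ⟨w, hw, hwn⟩ := SetLike.not_le_iff_exists.1 hn
    obtain ⟨c, hc, hc'⟩ := exists_dual_eq_one hwn
    have hcI : ∀ x ∈ I, c x = 0 := fun x hx => hc' x (Submodule.mem_sup_left hx)
    have hwl : w ∉ I ⊔ Submodule.span k {l} := fun hmem => hwn
      ((sup_le le_sup_left ((Submodule.span_singleton_le_iff_mem l _).2 h)) hmem)
    exact (PairRel.of_notMem hw hl hcI ha hc hal hwl).symm.trans
      (PairRel.of_notMem hw hm hcI hb hc hbm hwn)
  · exact PairRel.of_notMem hl hm ha hb hal hbm h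

end Transvections

/-! ### Morphisms as pairs of a linear map and a retraction. -/

namespace VICU

variable {k : Type u} [Field k] {U : Subgroup kˣ}

/-- The linear map underlying a morphism. -/
def lin {V W : VICU U} (f : V ⟶ W) : V →ₗ[k] W := Hom.toLin f

/-- The retraction of the linear map underlying a morphism along the chosen complement. -/
noncomputable def retr {V W : VICU U} (f : V ⟶ W) : W →ₗ[k] V :=
  LinearMap.linearProjOfIsCompl (Hom.compl f) (Hom.toLin f) (Hom.injective f) (Hom.isCompl f)

section Morphisms

variable {V W X : VICU U}

theorem lin_injective (f : V ⟶ W) : Function.Injective (lin f) := Hom.injective f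

@[simp] theorem lin_id (x : V) : lin (𝟙 V) x = x := rfl

@[simp] theorem lin_comp (f : V ⟶ W) (g : W ⟶ X) (x : V) : lin (f ≫ g) x = lin g (lin f x) := rfl

@[simp] theorem retr_lin (f : V ⟶ W) (x : V) : retr f (lin f x) = x :=
  LinearMap.linearProjOfIsCompl_apply_left _ _ _ _ x

theorem ker_retr (f : V ⟶ W) : LinearMap.ker (retr f) = Hom.compl f :=
  LinearMap.ker_linearProjOfIsCompl _ _ _ _

theorem retr_surjective (f : V ⟶ W) : Function.Surjective (retr f) :=
  fun x => ⟨_, retr_lin f x⟩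

/-- The complement is the kernel of the retraction, so identities between morphisms become
identities between linear maps. -/
theorem hom_ext {f g : V ⟶ W} (h : ∀ x, lin f x = lin g x) (h' : ∀ x, retr f x = retr g x) :
    f = g := by
  refine Hom.ext (LinearMap.ext h) ?_
  rw [← ker_retr, ← ker_retr, LinearMap.ext h']

theorem retr_unique (f : V ⟶ W) (S : W →ₗ[k] V) (h : ∀ x, S (lin f x) = x)
    (h' : ∀ x ∈ Hom.compl f, S x = 0) (x : W) : S x = retr f x := by
  have hx : x ∈ LinearMap.range (lin f) ⊔ Hom.compl f := by
    rw [show LinearMap.range (lin f) ⊔ Hom.compl f = ⊤ from (Hom.isCompl f).sup_eq_top]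
    trivial
  obtain ⟨_, ⟨y, rfl⟩, z, hz, rfl⟩ := Submodule.mem_sup.1 hx
  have hz' : retr f z = 0 := by rwa [← LinearMap.mem_ker, ker_retr]
  simp [h, h' z hz, hz']

@[simp] theorem retr_comp (f : V ⟶ W) (g : W ⟶ X) (x : X) :
    retr (f ≫ g) x = retr f (retr g x) := by
  refine (retr_unique (f ≫ g) (retr f ∘ₗ retr g) (fun y => by simp) (fun y hy => ?_) x).symm
  obtain ⟨a, ha, _, ⟨b, hb, rfl⟩, rfl⟩ := Submodule.mem_sup.1
    (show y ∈ Hom.compl g ⊔ (Hom.compl f).map (Hom.toLin g) from hy)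
  rw [← ker_retr, LinearMap.mem_ker] at ha
  rw [SetLike.mem_coe, ← ker_retr, LinearMap.mem_ker] at hb
  have := retr_lin g b
  simp only [LinearMap.comp_apply, map_add, ha, map_zero, zero_add]
  rw [show retr g (Hom.toLin g b) = b from this, hb]

/-- A morphism between objects of different ranks, given by a linear map and a retraction. -/
def mkHom (T : V →ₗ[k] W) (S : W →ₗ[k] V) (h : ∀ x, S (T x) = x) (hr : V.rank < W.rank) :
    V ⟶ W where
  toLin := T
  compl := LinearMap.ker S
  injective := Function.LeftInverse.injective h
  isCompl := by
    constructor
    · rw [Submodule.disjoint_def]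
      rintro _ ⟨x, rfl⟩ hx
      rw [← h x, LinearMap.mem_ker.1 hx, map_zero]
    · rw [codisjoint_iff, eq_top_iff]
      intro x _
      rw [← add_sub_cancel (T (S x)) x]
      exact Submodule.add_mem_sup ⟨S x, rfl⟩ (by simp [h])
  map_orient h := absurd h hr.ne

@[simp] theorem lin_mkHom (T : V →ₗ[k] W) (S : W →ₗ[k] V) (h : ∀ x, S (T x) = x)
    (hr : V.rank < W.rank) (x : V) : lin (mkHom T S h hr) x = T x := rfl

@[simp] theorem retr_mkHom (T : V →ₗ[k] W) (S : W →ₗ[k] V) (h : ∀ x, S (T x) = x)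
    (hr : V.rank < W.rank) (x : W) : retr (mkHom T S h hr) x = S x :=
  (retr_unique (mkHom T S h hr) S h (fun _ hx => hx) x).symm

theorem finrank_ker_retr (f : V ⟶ W) :
    Module.finrank k (LinearMap.ker (retr f)) + V.rank = W.rank := by
  have h := LinearMap.finrank_range_add_finrank_ker (retr f)
  rw [LinearMap.range_eq_top.2 (retr_surjective f), finrank_top] at h
  rw [add_comm]
  exact h

theorem finrank_range_lin (f : V ⟶ W) : Module.finrank k (LinearMap.range (lin f)) = V.rank :=
  LinearMap.finrank_range_of_inj (lin_injective f)

instance (f : V ⟶ W) : Mono f where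
  right_cancellation g h e := by
    refine hom_ext (fun x => lin_injective f ?_) (fun x => ?_)
    · rw [← lin_comp, e, lin_comp]
    · obtain ⟨y, rfl⟩ := retr_surjective f x
      rw [← retr_comp, e, retr_comp]

end Morphisms

/-! ### Automorphisms and determinants. -/

section Automorphisms

theorem map_topForm {V : Type u} [AddCommGroup V] [Module k V] [Module.Finite k V]
    (g : V →ₗ[k] V) {ω : ExteriorAlgebra k V} (hω : ω ∈ ⋀[k]^(Module.finrank k V) V) :
    ExteriorAlgebra.map g ω = LinearMap.det g • ω := by
  let b := Module.finBasis k V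
  rw [← span_ιMulti_basis b] at hω
  obtain ⟨a, rfl⟩ := Submodule.mem_span_singleton.1 hω
  have h1 : ExteriorAlgebra.ιMulti k (Module.finrank k V) (g ∘ b) ∈
      Submodule.span k {ExteriorAlgebra.ιMulti k (Module.finrank k V) b} := by
    rw [span_ιMulti_basis b, ← ExteriorAlgebra.ιMulti_span_fixedDegree]
    exact Submodule.subset_span ⟨_, rfl⟩
  have h : ExteriorAlgebra.ιMulti k (Module.finrank k V) =
      (LinearMap.toSpanSingleton k (ExteriorAlgebra k V)
        (ExteriorAlgebra.ιMulti k (Module.finrank k V) b)).compAlternatingMap b.det := by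
    refine Module.Basis.ext_alternating b fun f hf => ?_
    let σ : Equiv.Perm (Fin (Module.finrank k V)) :=
      Equiv.ofBijective f (Finite.injective_iff_bijective.1 hf)
    change ExteriorAlgebra.ιMulti k _ (b ∘ σ) = b.det (b ∘ σ) • ExteriorAlgebra.ιMulti k _ b
    rw [AlternatingMap.map_perm, AlternatingMap.map_perm, b.det_self]
    rcases Int.units_eq_one_or (Equiv.Perm.sign σ) with hs | hs <;> simp [hs]
  have h2 : ExteriorAlgebra.ιMulti k (Module.finrank k V) (g ∘ b) =
      LinearMap.det g • ExteriorAlgebra.ιMulti k (Module.finrank k V) b := by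
    refine (congrArg (fun t => t (g ∘ b)) h).trans ?_
    change b.det (g ∘ b) • ExteriorAlgebra.ιMulti k _ b = _
    rw [b.det_comp, b.det_self, mul_one]
  rw [map_smul, ExteriorAlgebra.map_apply_ιMulti, h2, smul_comm]

variable {V : VICU U}

/-- On the top exterior power g acts as multiplication by det g, and the orientation is one
`U`-orbit of a nonzero element. -/
theorem image_gens_eq_iff (hV : Nontrivial V) (g : V ≃ₗ[k] V) :
    ExteriorAlgebra.map (g : V →ₗ[k] V) '' (V.orient hV).gens = (V.orient hV).gens ↔
      LinearEquiv.det g ∈ U := by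
  obtain ⟨ω, hω, hg⟩ := (V.orient hV).exists_generator
  have hmem : ω ∈ ⋀[k]^(Module.finrank k V) V := hω ▸ Submodule.mem_span_singleton_self ω
  have hω0 : ω ≠ 0 := by
    rintro rfl
    have h1 := exteriorPower.finrank_eq (R := k) (M := V) (Module.finrank k V)
    rw [Nat.choose_self, ← hω, Submodule.span_zero_singleton, finrank_bot] at h1
    exact zero_ne_one h1
  have hmap (c : k) : ExteriorAlgebra.map (g : V →ₗ[k] V) (c • ω) =
      (c * (LinearEquiv.det g : kˣ)) • ω := by
    rw [map_smul, map_topForm _ hmem, smul_smul, LinearEquiv.coe_det]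
  rw [hg]
  constructor
  · intro h
    have h1 : ω ∈ {x | ∃ c ∈ U, x = (c : k) • ω} := ⟨1, U.one_mem, by simp⟩
    obtain ⟨c, hc, hc'⟩ := h ▸ Set.mem_image_of_mem (ExteriorAlgebra.map (g : V →ₗ[k] V)) h1
    have h2 := hmap 1
    rw [one_smul, hc', one_mul] at h2
    have h3 := smul_left_injective k hω0 h2
    rwa [← Units.ext h3]
  · intro h
    ext x
    constructor
    · rintro ⟨_, ⟨c, hc, rfl⟩, rfl⟩
      exact ⟨c * LinearEquiv.det g, U.mul_mem hc h, by rw [hmap]; simp⟩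
    · rintro ⟨c, hc, rfl⟩
      exact ⟨_, ⟨c * (LinearEquiv.det g)⁻¹, U.mul_mem hc (U.inv_mem h), rfl⟩,
        by rw [hmap, ← Units.val_mul, inv_mul_cancel_right]⟩

/-- An automorphism of `V` from a linear automorphism whose determinant lies in `U`. -/
def autOfLinearEquiv (g : V ≃ₗ[k] V) (hg : LinearEquiv.det g ∈ U) : V ≅ V :=
  isoOfLinearEquiv g fun hV _ => (image_gens_eq_iff hV g).2 hg

@[simp] theorem lin_autOfLinearEquiv (g : V ≃ₗ[k] V) (hg : LinearEquiv.det g ∈ U) (x : V) :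
    lin (autOfLinearEquiv g hg).hom x = g x := rfl

@[simp] theorem lin_hom_lin_inv (g : V ≅ V) (x : V) : lin g.hom (lin g.inv x) = x := by
  rw [← lin_comp]; simp

@[simp] theorem lin_inv_lin_hom (g : V ≅ V) (x : V) : lin g.inv (lin g.hom x) = x := by
  rw [← lin_comp]; simp

@[simp] theorem retr_hom (g : V ≅ V) (x : V) : retr g.hom x = lin g.inv x := by
  rw [← lin_hom_lin_inv g x, retr_lin, lin_inv_lin_hom]

/-- The linear automorphism underlying an automorphism. -/
def linEquiv (g : V ≅ V) : V ≃ₗ[k] V :=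
  LinearEquiv.ofLinearMap (lin g.hom) (lin g.inv) (LinearMap.ext (lin_hom_lin_inv g))
    (LinearMap.ext (lin_inv_lin_hom g))

@[simp] theorem linEquiv_apply (g : V ≅ V) (x : V) : linEquiv g x = lin g.hom x := rfl

@[simp] theorem linEquiv_symm_apply (g : V ≅ V) (x : V) : (linEquiv g).symm x = lin g.inv x := rfl

theorem det_linEquiv_mem (g : V ≅ V) : LinearEquiv.det (linEquiv g) ∈ U := by
  rcases subsingleton_or_nontrivial V with hV | hV
  · have : LinearEquiv.det (linEquiv g) = 1 := by
      rw [← Units.val_inj, LinearEquiv.coe_det, LinearMap.det_eq_one_of_subsingleton, Units.val_one]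
    rw [this]
    exact U.one_mem
  · exact (image_gens_eq_iff hV (linEquiv g)).1 (Hom.map_orient g.hom rfl hV hV)

theorem aut_ext {g g' : V ≅ V} (h : ∀ x, lin g.hom x = lin g'.hom x) : g = g' := by
  have : Function.Injective (linEquiv (V := V)) := fun a b hab => by
    refine Iso.ext (hom_ext (fun x => LinearEquiv.congr_fun hab x) fun x => ?_)
    rw [retr_hom, retr_hom, ← linEquiv_symm_apply, hab, linEquiv_symm_apply]
  exact this (LinearEquiv.ext h)

theorem lin_inv_autOfLinearEquiv (g : V ≃ₗ[k] V) (hg : LinearEquiv.det g ∈ U) (x : V) :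
    lin (autOfLinearEquiv g hg).inv x = g.symm x := rfl

/-- The automorphisms of the target that fix a morphism. -/
def Stab {X V : VICU U} (h : X ⟶ V) : Type u := {g : V ≅ V // h ≫ g.hom = h}

theorem comp_hom_eq_of {X V : VICU U} {h : X ⟶ V} {g : V ≅ V}
    (h1 : ∀ x, lin g.hom (lin h x) = lin h x) (h2 : ∀ x, retr h (lin g.hom x) = retr h x) :
    h ≫ g.hom = h := by
  refine hom_ext h1 fun x => ?_
  rw [retr_comp, retr_hom, ← h2, lin_hom_lin_inv]

instance [Finite k] : Finite (V ≅ V) := by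
  have := Module.finite_of_finite k (M := V)
  refine Finite.of_injective (fun g : V ≅ V => (lin g.hom : V → V)) fun g g' h => aut_ext fun x => ?_
  exact congrFun h x

instance [Finite k] {X V : VICU U} (h : X ⟶ V) : Finite (Stab h) :=
  inferInstanceAs (Finite {g : V ≅ V // h ≫ g.hom = h})

instance {X V : VICU U} (h : X ⟶ V) : Nonempty (Stab h) := ⟨⟨Iso.refl V, Category.comp_id h⟩⟩

end Automorphisms

/-! ### Splitting off a line. -/

section Hyperplane

variable {V : VICU U}

/-- The kernel of a linear form, with an arbitrary orientation. -/
noncomputable def kerObj (V : VICU U) (a : Module.Dual k V) : VICU U where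
  carrier := LinearMap.ker a
  orient _ := orientOfBasis U (Module.finBasis k (LinearMap.ker a))

theorem rank_kerObj {a : Module.Dual k V} {l : V} (h : a l = 1) :
    (kerObj V a).rank + 1 = V.rank := by
  have h1 := LinearMap.finrank_range_add_finrank_ker a
  have h2 : LinearMap.range a = ⊤ := LinearMap.range_eq_top.2 fun c => ⟨c • l, by simp [h]⟩
  rw [h2, finrank_top, Module.finrank_self, add_comm] at h1
  exact h1

/-- The inclusion of the kernel of a linear form. -/
def subKer (V : VICU U) (a : Module.Dual k V) : kerObj V a →ₗ[k] V := (LinearMap.ker a).subtype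

theorem subKer_injective (V : VICU U) (a : Module.Dual k V) : Function.Injective (subKer V a) :=
  Subtype.val_injective

theorem apply_subKer {a : Module.Dual k V} (x : kerObj V a) : a (subKer V a x) = 0 :=
  LinearMap.mem_ker.1 (show LinearMap.ker a from x).2

/-- The projection to the kernel of a linear form along a vector. -/
def projKer {a : Module.Dual k V} {l : V} (h : a l = 1) : V →ₗ[k] kerObj V a :=
  LinearMap.codRestrict _ (LinearMap.id - a.smulRight l) fun x => by simp [h]

@[simp] theorem subKer_projKer {a : Module.Dual k V} {l : V} (h : a l = 1) (x : V) :
    subKer V a (projKer h x) = x - a x • l := rfl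

/-- The inclusion of the kernel of `a`, with complement spanned by `l`. -/
noncomputable def incKer {a : Module.Dual k V} {l : V} (h : a l = 1) : kerObj V a ⟶ V :=
  mkHom (subKer V a) (projKer h)
    (fun x => subKer_injective V a (by rw [subKer_projKer, apply_subKer, zero_smul, sub_zero]))
    (by have := rank_kerObj h; omega)

@[simp] theorem apply_lin_incKer {a : Module.Dual k V} {l : V} (h : a l = 1) (x : kerObj V a) :
    a (lin (incKer h) x) = 0 := apply_subKer x

@[simp] theorem lin_incKer_retr {a : Module.Dual k V} {l : V} (h : a l = 1) (x : V) :
    lin (incKer h) (retr (incKer h) x) = x - a x • l := by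
  rw [incKer, retr_mkHom, lin_mkHom, subKer_projKer]

theorem retr_incKer_self {a : Module.Dual k V} {l : V} (h : a l = 1) : retr (incKer h) l = 0 := by
  apply lin_injective (incKer h)
  rw [lin_incKer_retr]
  simp [h]

/-- The two conditions say that the hyperplane contains the image of f and that the line of l lies
in its complement. The gap of two in rank keeps `Y` strictly smaller than the hyperplane, so the
arbitrary orientation of the latter imposes nothing. -/
theorem exists_comp_incKer {Y : VICU U} {a : Module.Dual k V} {l : V} (h : a l = 1) (f : Y ⟶ V)
    (hr : Y.rank + 1 < V.rank) (h1 : ∀ x, a (lin f x) = 0) (h2 : retr f l = 0) :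
    ∃ f₁ : Y ⟶ kerObj V a, f₁ ≫ incKer h = f := by
  have hr' := rank_kerObj h
  refine ⟨mkHom (retr (incKer h) ∘ₗ lin f) (retr f ∘ₗ lin (incKer h)) (fun x => ?_) (by omega),
    hom_ext (fun x => ?_) (fun x => ?_)⟩
  · simp [lin_incKer_retr, h1]
  · simp [lin_incKer_retr, h1]
  · simp [lin_incKer_retr, h2]

end Hyperplane

end VICU

/-! ### Orbits of morphisms under stabilizers. -/

namespace VICU

variable {k : Type u} [Field k] {U : Subgroup kˣ} {V X Y : VICU U}

/-- The intersection of the complements has dimension at least dim V - dim X - dim Y. Its part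
inside the sum of the images lies in a complement of the image of p within that sum, so has
dimension at most dim Y. This is where the coefficient 2 of `Y.rank` comes from. -/
theorem finrank_inf_add_two_le (p : X ⟶ V) (f : Y ⟶ V) (hr : X.rank + 2 * Y.rank + 2 ≤ V.rank) :
    Module.finrank k ↥((LinearMap.ker (retr p) ⊓ LinearMap.ker (retr f)) ⊓
      (LinearMap.range (lin p) ⊔ LinearMap.range (lin f))) + 2 ≤
      Module.finrank k ↥(LinearMap.ker (retr p) ⊓ LinearMap.ker (retr f)) := by
  have h1 := Submodule.finrank_sup_add_finrank_inf_eq (LinearMap.ker (retr p))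
    (LinearMap.ker (retr f))
  have h2 := Submodule.finrank_sup_add_finrank_inf_eq (LinearMap.ker (retr p))
    (LinearMap.range (lin p) ⊔ LinearMap.range (lin f))
  have h3 : LinearMap.ker (retr p) ⊔ (LinearMap.range (lin p) ⊔ LinearMap.range (lin f)) = ⊤ := by
    rw [eq_top_iff, ← show LinearMap.range (lin p) ⊔ Hom.compl p = ⊤ from
      (Hom.isCompl p).sup_eq_top, ker_retr]
    exact sup_le (le_sup_left.trans le_sup_right) le_sup_left
  have h4 := Submodule.finrank_add_le_finrank_add_finrank (LinearMap.range (lin p))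
    (LinearMap.range (lin f))
  have h5 : Module.finrank k ↥((LinearMap.ker (retr p) ⊓ LinearMap.ker (retr f)) ⊓
      (LinearMap.range (lin p) ⊔ LinearMap.range (lin f))) ≤
      Module.finrank k ↥(LinearMap.ker (retr p) ⊓
        (LinearMap.range (lin p) ⊔ LinearMap.range (lin f))) :=
    Submodule.finrank_mono (inf_le_inf_right _ inf_le_left)
  have h6 : Module.finrank k ↥(LinearMap.ker (retr p) ⊔ LinearMap.ker (retr f)) ≤ V.rank :=
    Submodule.finrank_le _
  rw [h3, finrank_top, show Module.finrank k V = V.rank from rfl] at h2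
  rw [finrank_range_lin, finrank_range_lin] at h4
  have h7 := finrank_ker_retr p
  have h8 := finrank_ker_retr f
  omega

/-- Two pairs that both split off a line away from the images of `p` and `f` and inside their
complements are related by an automorphism that fixes `p` and `f`. -/
theorem exists_aut_of_pairs (p : X ⟶ V) (f : Y ⟶ V) (hr : X.rank + 2 * Y.rank + 2 ≤ V.rank)
    {a b : Module.Dual k V} {l m : V} (hal : a l = 1) (hbm : b m = 1)
    (hap : ∀ x, a (lin p x) = 0) (hbp : ∀ x, b (lin p x) = 0) (hpl : retr p l = 0)
    (hpm : retr p m = 0) (haf : ∀ x, a (lin f x) = 0) (hbf : ∀ x, b (lin f x) = 0)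
    (hfl : retr f l = 0) (hfm : retr f m = 0) :
    ∃ g : V ≅ V, p ≫ g.hom = p ∧ f ≫ g.hom = f ∧ lin g.hom l = m ∧
      ∀ x, b (lin g.hom x) = a x := by
  have key {c : Module.Dual k V} (hp : ∀ x, c (lin p x) = 0) (hf : ∀ x, c (lin f x) = 0) :
      ∀ x ∈ LinearMap.range (lin p) ⊔ LinearMap.range (lin f), c x = 0 := by
    intro x hx
    obtain ⟨_, ⟨y, rfl⟩, _, ⟨z, rfl⟩, rfl⟩ := Submodule.mem_sup.1 hx
    simp [hp, hf]
  obtain ⟨u, h1, h2, h3, h4, h5⟩ := PairRel.of_finrank (finrank_inf_add_two_le p f hr)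
    (l := l) (m := m) ⟨hpl, hfl⟩ ⟨hpm, hfm⟩ (key hap haf) (key hbp hbf) hal hbm
  -- Determinant one makes u an automorphism whatever `U` is.
  refine ⟨autOfLinearEquiv u (h1 ▸ U.one_mem),
    comp_hom_eq_of (fun x => h2 _ (Submodule.mem_sup_left ⟨x, rfl⟩)) (fun x => ?_),
    comp_hom_eq_of (fun x => h2 _ (Submodule.mem_sup_right ⟨x, rfl⟩)) (fun x => ?_), h4, h5⟩
  · rw [← sub_eq_zero, ← map_sub]
    exact (h3 x).1
  · rw [← sub_eq_zero, ← map_sub]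
    exact (h3 x).2

/-- Up to automorphisms fixing `p`, every morphism from an object of small rank factors through
the kernel of a linear form vanishing on `p`. -/
theorem exists_aut_comp_eq_comp_incKer (p : X ⟶ V) (f : Y ⟶ V)
    (hr : X.rank + 2 * Y.rank + 2 ≤ V.rank) {a : Module.Dual k V} {l : V} (h : a l = 1)
    (hap : ∀ x, a (lin p x) = 0) (hpl : retr p l = 0) :
    ∃ g : V ≅ V, p ≫ g.hom = p ∧ ∃ f₁ : Y ⟶ kerObj V a, f₁ ≫ incKer h = f ≫ g.hom := by
  have h1 := finrank_inf_add_two_le p f hr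
  obtain ⟨m, hm, hm'⟩ : ∃ m ∈ LinearMap.ker (retr p) ⊓ LinearMap.ker (retr f),
      m ∉ LinearMap.range (lin p) ⊔ LinearMap.range (lin f) := by
    rw [← SetLike.not_le_iff_exists]
    intro hle
    rw [inf_eq_left.2 hle] at h1
    omega
  obtain ⟨b, hb, hb'⟩ := exists_dual_eq_one hm'
  have hbp (x : X) : b (lin p x) = 0 := hb' _ (Submodule.mem_sup_left ⟨x, rfl⟩)
  have hbf (x : Y) : b (lin f x) = 0 := hb' _ (Submodule.mem_sup_right ⟨x, rfl⟩)
  -- The pair (m, b) is adapted to both p and f. Moving it to (l, a) while fixing only p carries f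
  -- to a morphism that factors through ker a.
  obtain ⟨u, hu1, hu2, hu3, hu4, hu5⟩ := PairRel.of_finrank (K := LinearMap.ker (retr p))
    (I := LinearMap.range (lin p)) (l := m) (m := l) (a := b) (b := a) (by
      have h2 : LinearMap.ker (retr p) ⊓ LinearMap.range (lin p) = ⊥ := by
        rw [ker_retr, inf_comm]
        exact (Hom.isCompl p).inf_eq_bot
      have h3 := finrank_ker_retr p
      rw [h2, finrank_bot]
      omega) hm.1 hpl (by rintro _ ⟨x, rfl⟩; exact hbp x) (by rintro _ ⟨x, rfl⟩; exact hap x) hb h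
  let g : V ≅ V := autOfLinearEquiv u (hu1 ▸ U.one_mem)
  have hgl : lin g.inv l = m := by
    rw [← show lin g.hom m = l from hu4, lin_inv_lin_hom]
  refine ⟨g, comp_hom_eq_of (fun x => hu2 _ ⟨x, rfl⟩) (fun x => ?_),
    exists_comp_incKer h _ (by omega) (fun x => ?_) ?_⟩
  · rw [← sub_eq_zero, ← map_sub]
    exact hu3 x
  · exact (hu5 _).trans (hbf x)
  · rw [retr_comp, retr_hom, hgl]
    exact hm.2

/-! ### Passing automorphisms between a hyperplane and the whole space. -/

section Extension

variable {a : Module.Dual k V} {l : V}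

/-- The decomposition into the kernel of `a` and the line of `l`. -/
noncomputable def splitKer (h : a l = 1) : (kerObj V a × k) ≃ₗ[k] V :=
  LinearEquiv.ofLinearMap ((lin (incKer h)).coprod (LinearMap.toSpanSingleton k V l))
    ((retr (incKer h)).prod a) (LinearMap.ext fun x => by simp)
    (LinearMap.ext fun x => Prod.ext (by simp [retr_incKer_self h]) (by simp [h]))

/-- A linear automorphism of the kernel of `a`, extended by the identity on the line of `l`. -/
noncomputable def extendKer (h : a l = 1) (t : kerObj V a ≃ₗ[k] kerObj V a) : V ≃ₗ[k] V :=
  ((splitKer h).symm.trans (t.prodCongr (LinearEquiv.refl k k))).trans (splitKer h)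

theorem extendKer_apply (h : a l = 1) (t : kerObj V a ≃ₗ[k] kerObj V a) (x : V) :
    extendKer h t x = lin (incKer h) (t (retr (incKer h) x)) + a x • l := rfl

theorem extendKer_symm_apply (h : a l = 1) (t : kerObj V a ≃ₗ[k] kerObj V a) (x : V) :
    (extendKer h t).symm x = lin (incKer h) (t.symm (retr (incKer h) x)) + a x • l := rfl

theorem det_extendKer (h : a l = 1) (t : kerObj V a ≃ₗ[k] kerObj V a) :
    LinearEquiv.det (extendKer h t) = LinearEquiv.det t := by
  rw [← Units.val_inj, LinearEquiv.coe_det, LinearEquiv.coe_det]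
  have h1 := LinearMap.det_prodMap (t : kerObj V a →ₗ[k] kerObj V a) (LinearMap.id : k →ₗ[k] k)
  rw [LinearMap.det_id, mul_one] at h1
  rw [← h1]
  exact LinearMap.det_conj _ (splitKer h)

theorem exists_extend (h : a l = 1) (g₀ : kerObj V a ≅ kerObj V a) :
    ∃ g : V ≅ V, incKer h ≫ g.hom = g₀.hom ≫ incKer h := by
  refine ⟨autOfLinearEquiv (extendKer h (linEquiv g₀))
    (by rw [det_extendKer]; exact det_linEquiv_mem g₀), hom_ext (fun x => ?_) (fun x => ?_)⟩
  · simp [extendKer_apply]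
  · rw [retr_comp, retr_comp, retr_hom, retr_hom, lin_inv_autOfLinearEquiv, extendKer_symm_apply]
    simp [retr_incKer_self h]

/-- Such a g preserves the splitting into ker a and the line of l and is the identity on the line,
so its restriction has the same determinant, which lies in `U`. -/
theorem exists_restrict (h : a l = 1) (g : V ≅ V) (hl : lin g.hom l = l)
    (ha : ∀ x, a (lin g.hom x) = a x) :
    ∃ g₀ : kerObj V a ≅ kerObj V a, incKer h ≫ g.hom = g₀.hom ≫ incKer h := by
  have hl' : lin g.inv l = l := by rw [← hl, lin_inv_lin_hom, hl]
  have ha' (x : V) : a (lin g.inv x) = a x := by rw [← ha, lin_hom_lin_inv]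
  let t : kerObj V a ≃ₗ[k] kerObj V a := LinearEquiv.ofLinearMap
    (retr (incKer h) ∘ₗ lin g.hom ∘ₗ lin (incKer h))
    (retr (incKer h) ∘ₗ lin g.inv ∘ₗ lin (incKer h))
    (LinearMap.ext fun x => by simp [ha'])
    (LinearMap.ext fun x => by simp [ha])
  have ht (x : kerObj V a) : t x = retr (incKer h) (lin g.hom (lin (incKer h) x)) := rfl
  have ht' (x : kerObj V a) : t.symm x = retr (incKer h) (lin g.inv (lin (incKer h) x)) := rfl
  have he : extendKer h t = linEquiv g := LinearEquiv.ext fun x => by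
    rw [extendKer_apply, ht, lin_incKer_retr, lin_incKer_retr, map_sub, map_smul, hl, linEquiv_apply,
      map_sub, map_smul, h, ha]
    simp
  refine ⟨autOfLinearEquiv t (by rw [← det_extendKer h, he]; exact det_linEquiv_mem g),
    hom_ext (fun x => ?_) (fun x => ?_)⟩
  · simp [ht, ha]
  · rw [retr_comp, retr_comp, retr_hom, retr_hom, lin_inv_autOfLinearEquiv, ht', lin_incKer_retr,
      map_sub, map_smul, hl', map_sub, map_smul, retr_incKer_self]
    simp

/-- Morphisms to the kernel of `a` that become conjugate under automorphisms fixing `p` are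
already conjugate under automorphisms of the kernel fixing `p`. -/
theorem exists_aut_kerObj (h : a l = 1) (p : X ⟶ kerObj V a) (f₁ f₂ : Y ⟶ kerObj V a)
    (hr : X.rank + 2 * Y.rank + 2 ≤ V.rank) (g : V ≅ V)
    (hg : (p ≫ incKer h) ≫ g.hom = p ≫ incKer h)
    (e : (f₁ ≫ incKer h) ≫ g.hom = f₂ ≫ incKer h) :
    ∃ g₀ : kerObj V a ≅ kerObj V a, p ≫ g₀.hom = p ∧ f₁ ≫ g₀.hom = f₂ := by
  have hc {Z : VICU U} {q q' : Z ⟶ kerObj V a} (hq : (q ≫ incKer h) ≫ g.hom = q' ≫ incKer h) :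
      (∀ x, (a ∘ₗ lin g.inv) (lin (q' ≫ incKer h) x) = 0) ∧
        retr (q' ≫ incKer h) (lin g.hom l) = 0 := by
    rw [← hq]
    refine ⟨fun x => by simp, ?_⟩
    rw [retr_comp, retr_hom, lin_inv_lin_hom, retr_comp, retr_incKer_self, map_zero]
  -- The translate of (l, a) by g and (l, a) itself are both adapted to p and f₂. Correcting g by an
  -- automorphism w that fixes p and f₂ and takes the first pair to the second gives one that
  -- restricts to the hyperplane.
  obtain ⟨w, hw1, hw2, hw3, hw4⟩ := exists_aut_of_pairs (p ≫ incKer h) (f₂ ≫ incKer h) hr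
    (a := a ∘ₗ lin g.inv) (b := a) (l := lin g.hom l) (m := l) (by simp [h]) h (hc hg).1
    (fun x => by simp) (hc hg).2 (by simp [retr_incKer_self h]) (hc e).1 (fun x => by simp)
    (hc e).2 (by simp [retr_incKer_self h])
  obtain ⟨g₀, hg₀⟩ := exists_restrict h (g ≪≫ w) (by simpa using hw3)
    (fun x => by simp [hw4])
  refine ⟨g₀, ?_, ?_⟩
  · rw [← cancel_mono (incKer h), Category.assoc, ← hg₀, Iso.trans_hom, ← Category.assoc,
      ← Category.assoc, hg, hw1]
  · rw [← cancel_mono (incKer h), Category.assoc, ← hg₀, Iso.trans_hom, ← Category.assoc,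
      ← Category.assoc, e, hw2]

end Extension

end VICU

namespace VICU

variable {k : Type u} [Field k] {U : Subgroup kˣ} {R : Type v}

section Action

variable [CommRing R] {V W X : VICU U}

/-- The linear map induced by a morphism on the values of a module. -/
def act (A : VICU U ⥤ ModuleCat.{max u v} R) (f : V ⟶ W) : A.obj V →ₗ[R] A.obj W := (A.map f).hom

variable (A B : VICU U ⥤ ModuleCat.{max u v} R)

theorem act_act (f : V ⟶ W) (g : W ⟶ X) (x : A.obj V) : act A g (act A f x) = act A (f ≫ g) x :=
  (congrArg (fun t => t.hom x) (A.map_comp f g)).symm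

@[simp] theorem act_id (x : A.obj V) : act A (𝟙 V) x = x :=
  congrArg (fun t => t.hom x) (A.map_id V)

theorem app_act {A B : VICU U ⥤ ModuleCat.{max u v} R} (φ : A ⟶ B) (f : V ⟶ W) (x : A.obj V) :
    (φ.app W).hom (act A f x) = act B f ((φ.app V).hom x) :=
  congrArg (fun t => t.hom x) (φ.naturality f)

theorem act_mem_lowerSpan (f : W ⟶ V) (h : W.rank < V.rank) (x : A.obj W) :
    act A f x ∈ lowerSpan A V :=
  Submodule.mem_iSup_of_mem W (Submodule.mem_iSup_of_mem f
    (Submodule.mem_iSup_of_mem h ⟨x, rfl⟩))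

end Action

/-! ### Averaging over stabilizers and over all automorphisms. -/

section Average

variable [Finite k] [Field R] {V W X : VICU U}

noncomputable instance (h : X ⟶ V) : Fintype (Stab h) := Fintype.ofFinite _

noncomputable instance : Fintype (V ≅ V) := Fintype.ofFinite _

/-- The average over the automorphisms that fix a morphism. -/
noncomputable def avg (A : VICU U ⥤ ModuleCat.{max u v} R) (h : X ⟶ V) : A.obj V →ₗ[R] A.obj V :=
  (Fintype.card (Stab h) : R)⁻¹ • ∑ g : Stab h, act A g.1.hom

variable {A B : VICU U ⥤ ModuleCat.{max u v} R}

theorem avg_apply (h : X ⟶ V) (x : A.obj V) :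
    avg A h x = (Fintype.card (Stab h) : R)⁻¹ • ∑ g : Stab h, act A g.1.hom x := by
  simp [avg, LinearMap.sum_apply]

theorem app_avg (φ : A ⟶ B) (h : X ⟶ V) (x : A.obj V) :
    (φ.app V).hom (avg A h x) = avg B h ((φ.app V).hom x) := by
  simp_rw [avg_apply, map_smul, map_sum, app_act]

theorem avg_act (h : X ⟶ V) {g : V ≅ V} (hg : h ≫ g.hom = h) (x : A.obj V) :
    avg A h (act A g.hom x) = avg A h x := by
  have hg' : h ≫ g.inv = h := by rw [Iso.comp_inv_eq, hg]
  let e : Stab h ≃ Stab h :=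
    { toFun s := ⟨g ≪≫ s.1, by rw [Iso.trans_hom, ← Category.assoc, hg, s.2]⟩
      invFun s := ⟨g.symm ≪≫ s.1, by rw [Iso.trans_hom, ← Category.assoc, Iso.symm_hom, hg', s.2]⟩
      left_inv s := Subtype.ext (by simp)
      right_inv s := Subtype.ext (by simp) }
  rw [avg_apply, avg_apply]
  congr 1
  refine Fintype.sum_equiv e _ _ fun s => ?_
  rw [act_act]
  rfl

theorem avg_mem (h : X ⟶ V) {L : Submodule R (A.obj V)}
    (hL : ∀ (g : V ≅ V), ∀ x ∈ L, act A g.hom x ∈ L) {x : A.obj V} (hx : x ∈ L) :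
    avg A h x ∈ L := by
  rw [avg_apply]
  exact L.smul_mem _ (L.sum_mem fun g _ => hL g.1 x hx)

theorem avg_eq_of_forall [CharZero R] (h : X ⟶ V) {E : Type*} [AddCommGroup E] [Module R E]
    (θ : A.obj V →ₗ[R] E) {x : A.obj V} {y : E} (hθ : ∀ g : Stab h, θ (act A g.1.hom x) = y) :
    θ (avg A h x) = y := by
  have hc : (Fintype.card (Stab h) : R) ≠ 0 := Nat.cast_ne_zero.2 Fintype.card_ne_zero
  simp_rw [avg_apply, map_smul, map_sum, hθ, Finset.sum_const, Finset.card_univ,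
    ← Nat.cast_smul_eq_nsmul R, smul_smul, inv_mul_cancel₀ hc, one_smul]

/-- Each automorphism fixing h extends to one fixing h ≫ j, which the outer average absorbs. -/
theorem avg_comp_act_avg [CharZero R] (h : X ⟶ W) (j : W ⟶ V)
    (hj : ∀ g₀ : W ≅ W, ∃ g : V ≅ V, j ≫ g.hom = g₀.hom ≫ j) (x : A.obj W) :
    avg A (h ≫ j) (act A j (avg A h x)) = avg A (h ≫ j) (act A j x) := by
  refine avg_eq_of_forall h (avg A (h ≫ j) ∘ₗ act A j) fun g₀ => ?_
  obtain ⟨g, hg⟩ := hj g₀.1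
  rw [LinearMap.comp_apply, act_act, ← hg, ← act_act, avg_act]
  rw [Category.assoc, hg, ← Category.assoc, g₀.2]

/-- The average over all automorphisms of the conjugates of a linear endomorphism. -/
noncomputable def avgConj (A : VICU U ⥤ ModuleCat.{max u v} R) (p : A.obj V →ₗ[R] A.obj V) :
    A.obj V →ₗ[R] A.obj V :=
  (Fintype.card (V ≅ V) : R)⁻¹ • ∑ g : V ≅ V, act A g.hom ∘ₗ p ∘ₗ act A g.inv

theorem avgConj_apply (p : A.obj V →ₗ[R] A.obj V) (x : A.obj V) :
    avgConj A p x =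
      (Fintype.card (V ≅ V) : R)⁻¹ • ∑ g : V ≅ V, act A g.hom (p (act A g.inv x)) := by
  simp [avgConj, LinearMap.sum_apply]

theorem avgConj_act (p : A.obj V →ₗ[R] A.obj V) (g : V ≅ V) (x : A.obj V) :
    avgConj A p (act A g.hom x) = act A g.hom (avgConj A p x) := by
  let e : (V ≅ V) ≃ (V ≅ V) :=
    { toFun s := s ≪≫ g.symm
      invFun s := s ≪≫ g
      left_inv s := by simp
      right_inv s := by simp }
  rw [avgConj_apply, avgConj_apply, map_smul, map_sum]
  congr 1
  refine Fintype.sum_equiv e _ _ fun s => ?_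
  rw [act_act, act_act]
  simp [e]

theorem avgConj_avg (p : A.obj V →ₗ[R] A.obj V) (h : X ⟶ V) (x : A.obj V) :
    avgConj A p (avg A h x) = avg A h (avgConj A p x) := by
  simp_rw [avg_apply, map_smul, map_sum, avgConj_act]

theorem avgConj_mem {L : Submodule R (A.obj V)}
    (hL : ∀ (g : V ≅ V), ∀ x ∈ L, act A g.hom x ∈ L) (p : A.obj V →ₗ[R] A.obj V)
    (hp : ∀ x, p x ∈ L) (x : A.obj V) : avgConj A p x ∈ L := by
  rw [avgConj_apply]
  exact L.smul_mem _ (L.sum_mem fun g _ => hL g _ (hp _))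

/-- Together with `avgConj_mem` and `avgConj_act` this is Maschke's argument: a linear projection
onto an invariant submodule averages to an equivariant one. -/
theorem avgConj_eq_self [CharZero R] {L : Submodule R (A.obj V)}
    (hL : ∀ (g : V ≅ V), ∀ x ∈ L, act A g.hom x ∈ L) (p : A.obj V →ₗ[R] A.obj V)
    (hp : ∀ x ∈ L, p x = x) {x : A.obj V} (hx : x ∈ L) : avgConj A p x = x := by
  have h1 (g : V ≅ V) : act A g.hom (p (act A g.inv x)) = x := by
    rw [hp (act A g.inv x) (hL g.symm x hx), act_act]
    simp
  have : Nonempty (V ≅ V) := ⟨Iso.refl V⟩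
  have hc : (Fintype.card (V ≅ V) : R) ≠ 0 := Nat.cast_ne_zero.2 Fintype.card_ne_zero
  simp_rw [avgConj_apply, h1, Finset.sum_const, Finset.card_univ,
    ← Nat.cast_smul_eq_nsmul R, smul_smul, inv_mul_cancel₀ hc, one_smul]

end Average

/-! ### Free modules on families of objects. -/

section Free

/-- The generators of the value at `V` of the free module on a family of objects. -/
abbrev Gen {J : Type max u v} (Y : J → VICU U) (V : VICU U) : Type max u v := Σ j, (Y j ⟶ V)

/-- Postcomposition on generators. -/
def push {J : Type max u v} {Y : J → VICU U} {V W : VICU U} (f : V ⟶ W) (s : Gen Y V) : Gen Y W :=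
  ⟨s.1, s.2 ≫ f⟩

variable {J : Type max u v} {Y : J → VICU U} {V W X : VICU U}

theorem push_injective (f : V ⟶ W) : Function.Injective (push (Y := Y) f) := by
  rintro ⟨i, s⟩ ⟨j, t⟩ h
  obtain rfl : i = j := congrArg Sigma.fst h
  exact Sigma.ext rfl (heq_of_eq ((cancel_mono f).1 (eq_of_heq (Sigma.ext_iff.1 h).2)))

@[simp] theorem push_push (f : V ⟶ W) (g : W ⟶ X) (s : Gen Y V) :
    push g (push f s) = push (f ≫ g) s := by simp [push]

@[simp] theorem push_id (s : Gen Y V) : push (𝟙 V) s = s := by simp [push]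

variable (R) [CommRing R] (Y)

/-- The direct sum of the free modules on the functors represented by a family of objects. -/
noncomputable def freeMod : VICU U ⥤ ModuleCat.{max u v} R where
  obj V := ModuleCat.of R (Gen Y V →₀ R)
  map f := ModuleCat.ofHom (Finsupp.lmapDomain R R (push f))
  map_id V := by
    refine ModuleCat.hom_ext (LinearMap.ext fun x => ?_)
    exact (congrArg (fun t => Finsupp.mapDomain t x) (funext push_id)).trans Finsupp.mapDomain_id
  map_comp f g := by
    refine ModuleCat.hom_ext (LinearMap.ext fun x => ?_)
    refine Eq.trans ?_ Finsupp.mapDomain_comp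
    exact congrArg (fun t => Finsupp.mapDomain t x) (funext fun s => (push_push f g s).symm)

/-- The value of a free module, as a module of finitely supported functions. -/
noncomputable def freeEquiv (V : VICU U) : (Gen Y V →₀ R) ≃ₗ[R] (freeMod R Y).obj V :=
  LinearEquiv.refl R _

variable {R Y}

theorem act_freeEquiv (f : V ⟶ W) (x : Gen Y V →₀ R) :
    act (freeMod R Y) f (freeEquiv R Y V x) = freeEquiv R Y W (Finsupp.mapDomain (push f) x) := rfl

theorem freeEquiv_symm_act (f : V ⟶ W) (x : (freeMod R Y).obj V) :
    (freeEquiv R Y W).symm (act (freeMod R Y) f x) =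
      Finsupp.mapDomain (push f) ((freeEquiv R Y V).symm x) := rfl

/-- The orbit relation on generators under the automorphisms that fix `p`. -/
def orbitSetoid (Y : J → VICU U) (p : X ⟶ V) : Setoid (Gen Y V) where
  r s t := ∃ g : V ≅ V, p ≫ g.hom = p ∧ push g.hom s = t
  iseqv :=
    { refl s := ⟨Iso.refl V, Category.comp_id p, push_id s⟩
      symm := by
        rintro s _ ⟨g, hg, rfl⟩
        exact ⟨g.symm, by rw [Iso.symm_hom, Iso.comp_inv_eq, hg], by simp⟩
      trans := by
        rintro s _ _ ⟨g, hg, rfl⟩ ⟨g', hg', rfl⟩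
        exact ⟨g ≪≫ g', by rw [Iso.trans_hom, ← Category.assoc, hg, hg'], by simp⟩ }

end Free

/-! ### Orbit stability and generation degrees of kernels. -/

section Stability

variable [Finite k] [Field R] {J : Type max u v} {Y : J → VICU U} {V X : VICU U}

/-- The stabilizer of f permutes the generators and fixes ⟨j, f⟩, so that coefficient is unchanged.
-/
theorem freeEquiv_symm_avg_apply [CharZero R] {j : J} (f : Y j ⟶ V) (x : (freeMod R Y).obj V) :
    (freeEquiv R Y V).symm (avg (freeMod R Y) f x) ⟨j, f⟩ = (freeEquiv R Y V).symm x ⟨j, f⟩ := by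
  refine avg_eq_of_forall f (Finsupp.lapply ⟨j, f⟩ ∘ₗ (freeEquiv R Y V).symm.toLinearMap)
    fun g => ?_
  change (freeEquiv R Y V).symm (act (freeMod R Y) g.1.hom x) ⟨j, f⟩ = _
  have h : push (Y := Y) g.1.hom ⟨j, f⟩ = ⟨j, f⟩ := by rw [push, g.2]
  rw [freeEquiv_symm_act]
  nth_rw 1 [← h]
  exact Finsupp.mapDomain_apply (push_injective _) _ _

/-- Membership in an invariant submodule can be tested after averaging over the stabilizers of
generators. -/
theorem mem_of_avg_mem [CharZero R] {M : VICU U ⥤ ModuleCat.{max u v} R} (ι : M ⟶ freeMod R Y)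
    (hι : Function.Injective (ι.app V).hom) {L : Submodule R (M.obj V)}
    (hL : ∀ (g : V ≅ V), ∀ x ∈ L, act M g.hom x ∈ L) {x : M.obj V}
    (hx : ∀ j (f : Y j ⟶ V), avg M f x ∈ L) : x ∈ L := by
  let L' : Submodule R ((freeMod R Y).obj V) := L.map (ι.app V).hom
  have hL' (g : V ≅ V) : ∀ y ∈ L', act (freeMod R Y) g.hom y ∈ L' := by
    rintro _ ⟨y, hy, rfl⟩
    exact ⟨_, hL g y hy, app_act ι g.hom y⟩
  obtain ⟨q, hq⟩ := LinearMap.exists_leftInverse_of_injective L'.subtype L'.ker_subtype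
  let p := avgConj (freeMod R Y) (L'.subtype ∘ₗ q)
  have hp1 (y) : p y ∈ L' := avgConj_mem hL' _ (fun y => (q y).2) y
  have hp2 {y} (hy : y ∈ L') : p y = y := by
    refine avgConj_eq_self hL' _ (fun z hz => ?_) hy
    exact congrArg L'.subtype (LinearMap.congr_fun hq ⟨z, hz⟩)
  -- The coefficient at ⟨j, f⟩ survives averaging over the stabilizer of f. That average of x lies
  -- in L', where p is the identity, so every coefficient of x - p x vanishes.
  have h0 : (ι.app V).hom x - p ((ι.app V).hom x) = 0 := by
    apply (freeEquiv R Y V).symm.injective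
    rw [map_zero]
    ext ⟨j, f⟩
    have h1 : avg (freeMod R Y) f ((ι.app V).hom x) ∈ L' := ⟨_, hx j f, app_avg ι f x⟩
    rw [← freeEquiv_symm_avg_apply, map_sub, ← avgConj_avg, hp2 h1, sub_self, map_zero]
  obtain ⟨y, hy, hyx⟩ := hp1 ((ι.app V).hom x)
  rw [← sub_eq_zero.1 h0] at hyx
  rwa [← hι hyx]

variable {a : Module.Dual k V} {l : V}

theorem exists_avg_eq_avg_act_incKer (h : a l = 1) (p : X ⟶ V) (hap : ∀ x, a (lin p x) = 0)
    (hpl : retr p l = 0) (hY : ∀ j, X.rank + 2 * (Y j).rank + 2 ≤ V.rank)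
    (y : (freeMod R Y).obj V) :
    ∃ z, avg (freeMod R Y) p y = avg (freeMod R Y) p (act (freeMod R Y) (incKer h) z) := by
  obtain ⟨y, rfl⟩ := (freeEquiv R Y V).surjective y
  induction y using Finsupp.induction_linear with
  | zero => exact ⟨0, by simp⟩
  | add y y' hy hy' =>
    obtain ⟨z, hz⟩ := hy
    obtain ⟨z', hz'⟩ := hy'
    exact ⟨z + z', by simp only [map_add, hz, hz']⟩
  | single s c =>
    obtain ⟨j, f⟩ := s
    obtain ⟨g, hg, f₁, hf₁⟩ := exists_aut_comp_eq_comp_incKer p f (hY j) h hap hpl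
    refine ⟨freeEquiv R Y _ (Finsupp.single ⟨j, f₁⟩ c), ?_⟩
    rw [← avg_act p hg, act_freeEquiv, act_freeEquiv, Finsupp.mapDomain_single,
      Finsupp.mapDomain_single, push, push, hf₁]

/-- Averages over the stabilizer of p are determined by sums of coefficients over its orbits, and
orbits on the hyperplane inject into orbits on V. -/
theorem avg_eq_zero_of_avg_act_incKer [CharZero R] (h : a l = 1) (p : X ⟶ kerObj V a)
    (hY : ∀ j, X.rank + 2 * (Y j).rank + 2 ≤ V.rank) {w : (freeMod R Y).obj (kerObj V a)}
    (hw : avg (freeMod R Y) (p ≫ incKer h) (act (freeMod R Y) (incKer h) w) = 0) :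
    avg (freeMod R Y) p w = 0 := by
  let r := orbitSetoid Y p
  let r' := orbitSetoid Y (p ≫ incKer h)
  let ψ : Quotient r → Quotient r' := Quotient.map (push (incKer h)) (by
    rintro s _ ⟨g₀, hg₀, rfl⟩
    obtain ⟨g, hg⟩ := exists_extend h g₀
    exact ⟨g, by rw [Category.assoc, hg, ← Category.assoc, hg₀], by simp [hg]⟩)
  have hψ : Function.Injective ψ := by
    rintro ⟨i, f₁⟩ ⟨j, f₂⟩ hq
    obtain ⟨g, hg, e⟩ := Quotient.exact hq
    obtain rfl : i = j := congrArg Sigma.fst e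
    obtain ⟨g₀, h1, h2⟩ := exists_aut_kerObj h p f₁ f₂ (hY i) g hg
      (eq_of_heq (Sigma.ext_iff.1 e).2)
    exact Quotient.sound ⟨g₀, h1, by rw [push, h2]⟩
  -- γ sums coefficients over orbits, an operation unaffected by averaging.
  let γ : (freeMod R Y).obj V →ₗ[R] (Quotient r' →₀ R) :=
    Finsupp.lmapDomain R R (Quotient.mk r') ∘ₗ (freeEquiv R Y V).symm.toLinearMap
  have hγ (y) : γ (avg (freeMod R Y) (p ≫ incKer h) y) = γ y := by
    refine avg_eq_of_forall _ γ fun g => ?_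
    change Finsupp.mapDomain (Quotient.mk r') ((freeEquiv R Y V).symm (act _ g.1.hom y)) =
      Finsupp.mapDomain (Quotient.mk r') ((freeEquiv R Y V).symm y)
    rw [freeEquiv_symm_act, ← Finsupp.mapDomain_comp]
    congr 1
    funext s
    exact (Quotient.sound ⟨g.1, g.2, rfl⟩ : Quotient.mk r' s = _).symm
  have h1 : Finsupp.mapDomain (Quotient.mk r) ((freeEquiv R Y _).symm w) = 0 := by
    apply Finsupp.mapDomain_injective hψ
    rw [← Finsupp.mapDomain_comp, Finsupp.mapDomain_zero]
    have h2 := hγ (act (freeMod R Y) (incKer h) w)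
    rw [hw, map_zero] at h2
    refine Eq.trans ?_ h2.symm
    change _ = Finsupp.mapDomain (Quotient.mk r') ((freeEquiv R Y V).symm (act _ _ w))
    rw [freeEquiv_symm_act, ← Finsupp.mapDomain_comp]
    rfl
  -- σ recovers the average from the orbit sums: generators in one orbit have the same average.
  let σ : Quotient r → (freeMod R Y).obj (kerObj V a) :=
    Quotient.lift (fun s => avg (freeMod R Y) p (freeEquiv R Y _ (Finsupp.single s 1))) (by
      rintro s _ ⟨g, hg, rfl⟩
      change avg _ p _ = avg _ p _
      rw [← avg_act p hg, act_freeEquiv, Finsupp.mapDomain_single])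
  have hσ : avg (freeMod R Y) p ∘ₗ (freeEquiv R Y _).toLinearMap =
      Finsupp.linearCombination R σ ∘ₗ Finsupp.lmapDomain R R (Quotient.mk r) := by
    refine Finsupp.lhom_ext' fun s => LinearMap.ext_ring ?_
    simp [σ]
  have h3 := LinearMap.congr_fun hσ ((freeEquiv R Y _).symm w)
  simp only [LinearMap.comp_apply, Finsupp.lmapDomain_apply, h1, map_zero, LinearEquiv.coe_coe,
    LinearEquiv.apply_symm_apply] at h3
  exact h3

/-- The kernel of a map between free modules on objects of rank at most `N` is generated in ranks
at most `3 * N + 1`. -/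
theorem lowerSpan_eq_top_of_kernel [CharZero R] {J' : Type max u v} {Y' : J' → VICU U}
    {K : VICU U ⥤ ModuleCat.{max u v} R} (κ : K ⟶ freeMod R Y) (φ : freeMod R Y ⟶ freeMod R Y')
    (hκ : ∀ W, Function.Injective (κ.app W).hom)
    (hex : ∀ W, Function.Exact (κ.app W).hom (φ.app W).hom) {N : ℕ}
    (hY : ∀ j, (Y j).rank ≤ N) (hY' : ∀ j, (Y' j).rank ≤ N) (hV : 3 * N + 1 < V.rank) :
    lowerSpan K V = ⊤ := by
  rw [eq_top_iff]
  intro x _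
  have hstable (g : V ≅ V) : ∀ x ∈ lowerSpan K V, act K g.hom x ∈ lowerSpan K V :=
    fun x hx => lowerSpan_le_comap K g.hom hx
  refine mem_of_avg_mem κ (hκ V) hstable fun j p => ?_
  have hj := hY j
  obtain ⟨l, hl, hl0⟩ : ∃ l ∈ LinearMap.ker (retr p), l ≠ 0 := by
    rw [← Submodule.ne_bot_iff]
    intro h
    have h1 := finrank_ker_retr p
    rw [h, finrank_bot] at h1
    omega
  have hlp : l ∉ LinearMap.range (lin p) := by
    rintro ⟨y, rfl⟩
    rw [LinearMap.mem_ker, retr_lin] at hl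
    exact hl0 (by rw [hl, map_zero])
  obtain ⟨a, h, ha⟩ := exists_dual_eq_one hlp
  have hap (x) : a (lin p x) = 0 := ha _ ⟨x, rfl⟩
  obtain ⟨p₀, rfl⟩ := exists_comp_incKer h p (by omega) hap hl
  -- Three ranks at most N and `V.rank` at least 3N + 2 give exactly the room that orbit stability
  -- needs. Surjectivity on orbits is used in the source of φ, injectivity in its target.
  obtain ⟨z, hz⟩ := exists_avg_eq_avg_act_incKer h (p₀ ≫ incKer h) hap hl
    (fun i => by have := hY i; omega) ((κ.app V).hom x)
  have h1 : avg _ (p₀ ≫ incKer h) (act _ (incKer h) ((φ.app _).hom z)) = 0 := by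
    rw [← app_act, ← app_avg, ← hz, app_avg, (hex V).apply_apply_eq_zero, map_zero]
  have h2 := avg_eq_zero_of_avg_act_incKer h p₀ (fun i => by have := hY' i; omega) h1
  rw [← app_avg] at h2
  -- The average of z on the hyperplane is killed by φ, so it comes from the kernel there.
  obtain ⟨x₀, hx₀⟩ := (hex _ _).1 h2
  have h3 : avg K (p₀ ≫ incKer h) x = avg K (p₀ ≫ incKer h) (act K (incKer h) x₀) := by
    apply hκ V
    rw [app_avg, app_avg, app_act, hx₀, hz, avg_comp_act_avg _ _ (exists_extend h)]
  rw [h3]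
  have hr := rank_kerObj h
  exact avg_mem _ hstable (act_mem_lowerSpan K _ (by omega) x₀)

end Stability

end VICU

namespace VICU

variable {k : Type u} [Field k] {U : Subgroup kˣ}

/-! ### Projectivity and generation degree of free modules. -/

section Projective

variable {R : Type v} [CommRing R] {J : Type max u v} {Y : J → VICU U} {A B : VICU U ⥤ ModuleCat.{max u v} R}

/-- The generator of a free module given by an identity morphism. -/
noncomputable def gen (R : Type v) [CommRing R] (Y : J → VICU U) (j : J) :
    (freeMod R Y).obj (Y j) :=
  freeEquiv R Y (Y j) (Finsupp.single ⟨j, 𝟙 _⟩ 1)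

theorem freeEquiv_single {V : VICU U} (s : Gen Y V) :
    freeEquiv R Y V (Finsupp.single s 1) = act (freeMod R Y) s.2 (gen R Y s.1) := by
  rw [gen, act_freeEquiv, Finsupp.mapDomain_single, push, Category.id_comp]

/-- The map from a free module determined by the images of the generators. -/
noncomputable def freeLift (A : VICU U ⥤ ModuleCat.{max u v} R) (x : ∀ j, A.obj (Y j)) :
    freeMod R Y ⟶ A where
  app V := ModuleCat.ofHom (Finsupp.linearCombination R (fun s : Gen Y V => act A s.2 (x s.1)) ∘ₗ
    (freeEquiv R Y V).symm.toLinearMap)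
  naturality V W f := by
    refine ModuleCat.hom_ext ?_
    change Finsupp.linearCombination R (fun s : Gen Y W => act A s.2 (x s.1)) ∘ₗ
        Finsupp.lmapDomain R R (push f) =
      act A f ∘ₗ Finsupp.linearCombination R (fun s : Gen Y V => act A s.2 (x s.1))
    refine Finsupp.lhom_ext' fun s => LinearMap.ext_ring ?_
    simp [push, act_act]

theorem freeLift_gen (x : ∀ j, A.obj (Y j)) (j : J) :
    ((freeLift A x).app (Y j)).hom (gen R Y j) = x j := by
  change Finsupp.linearCombination R (fun s : Gen Y (Y j) => act A s.2 (x s.1))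
    (Finsupp.single ⟨j, 𝟙 _⟩ 1) = x j
  simp

theorem freeLift_act_gen (x : ∀ j, A.obj (Y j)) (j : J) {V : VICU U} (f : Y j ⟶ V) :
    ((freeLift A x).app V).hom (act (freeMod R Y) f (gen R Y j)) = act A f (x j) := by
  rw [app_act, freeLift_gen]

theorem freeMod_hom_ext {φ ψ : freeMod R Y ⟶ A}
    (h : ∀ j, (φ.app (Y j)).hom (gen R Y j) = (ψ.app (Y j)).hom (gen R Y j)) : φ = ψ := by
  refine NatTrans.ext (funext fun V => ModuleCat.hom_ext ?_)
  have h1 : (φ.app V).hom ∘ₗ (freeEquiv R Y V).toLinearMap =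
      (ψ.app V).hom ∘ₗ (freeEquiv R Y V).toLinearMap := by
    refine Finsupp.lhom_ext' fun s => LinearMap.ext_ring ?_
    change (φ.app V).hom (freeEquiv R Y V (Finsupp.single s 1)) =
      (ψ.app V).hom (freeEquiv R Y V (Finsupp.single s 1))
    rw [freeEquiv_single, app_act, app_act, h]
  refine LinearMap.ext fun y => ?_
  obtain ⟨x, rfl⟩ := (freeEquiv R Y V).surjective y
  exact LinearMap.congr_fun h1 x

theorem app_surjective (φ : A ⟶ B) [Epi φ] (V : VICU U) : Function.Surjective (φ.app V).hom :=
  (ModuleCat.epi_iff_surjective _).1 inferInstance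

instance : Projective (freeMod R Y) where
  factors {E X} f e he := by
    choose x hx using fun j => app_surjective e (Y j) ((f.app (Y j)).hom (gen R Y j))
    refine ⟨freeLift E x, freeMod_hom_ext fun j => ?_⟩
    change (e.app _).hom (((freeLift E x).app _).hom _) = _
    rw [freeLift_gen, hx]

theorem lowerSpan_freeMod_eq_top {N : ℕ} (hY : ∀ j, (Y j).rank ≤ N) {V : VICU U}
    (hV : N < V.rank) : lowerSpan (freeMod R Y) V = ⊤ := by
  rw [eq_top_iff]
  intro y _
  obtain ⟨x, rfl⟩ := (freeEquiv R Y V).surjective y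
  induction x using Finsupp.induction_linear with
  | zero => simp
  | add x x' hx hx' => rw [map_add]; exact add_mem (hx trivial) (hx' trivial)
  | single s c =>
    rw [← mul_one c, ← smul_eq_mul, ← Finsupp.smul_single, map_smul, freeEquiv_single]
    exact Submodule.smul_mem _ _ (act_mem_lowerSpan _ _ ((hY s.1).trans_lt hV) _)

end Projective

/-! ### Free covers in bounded rank. -/

section Cover

variable {R : Type v} [CommRing R]

theorem rank_std (n : ℕ) : (std U n).rank = n := Module.finrank_fin_fun k

theorem rank_eq_of_iso {V W : VICU U} (e : V ≅ W) : V.rank = W.rank :=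
  le_antisymm (Hom.rank_le e.hom) (Hom.rank_le e.inv)

theorem nonempty_iso_std_rank (V : VICU U) : Nonempty (std U V.rank ≅ V) := by
  obtain ⟨n, ⟨e⟩⟩ := exists_iso_std V
  have h := rank_eq_of_iso e
  rw [rank_std] at h
  exact ⟨h ▸ e⟩

theorem isZero_obj_iff_std (A : VICU U ⥤ ModuleCat.{max u v} R) (V : VICU U) :
    IsZero (A.obj V) ↔ IsZero (A.obj (std U V.rank)) := by
  obtain ⟨e⟩ := nonempty_iso_std_rank V
  exact (A.mapIso e.symm).isZero_iff

theorem isZero_H0_iff (A : VICU U ⥤ ModuleCat.{max u v} R) (V : VICU U) :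
    IsZero (((H0 U R).obj A).obj V) ↔ lowerSpan A V = ⊤ := by
  rw [← Submodule.Quotient.subsingleton_iff]
  exact ModuleCat.isZero_iff_subsingleton (M := ModuleCat.of R (A.obj V ⧸ lowerSpan A V))

variable (A : VICU U ⥤ ModuleCat.{max u v} R) (N : ℕ)

/-- The objects indexing the generators of the free cover. -/
noncomputable def coverObj (s : Σ n : Fin (N + 1), A.obj (std U n)) : VICU U := std U s.1

/-- The free module on all the elements of `A` in ranks at most `N`. -/
noncomputable abbrev cover : VICU U ⥤ ModuleCat.{max u v} R := freeMod R (coverObj A N)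

/-- The canonical map from the free cover. -/
noncomputable def coverMap : cover A N ⟶ A := freeLift A fun s => s.2

variable {A N}

theorem rank_coverObj_le (s : Σ n : Fin (N + 1), A.obj (std U n)) : (coverObj A N s).rank ≤ N := by
  rw [coverObj, rank_std]
  exact Nat.lt_succ_iff.1 s.1.2

/-- Up to rank N every element is itself the image of a generator; above N it comes from smaller
ranks by induction. -/
theorem coverMap_surjective (hA : ∀ V : VICU U, N < V.rank → lowerSpan A V = ⊤) (V : VICU U) :
    Function.Surjective ((coverMap A N).app V).hom := by
  induction hn : V.rank using Nat.strong_induction_on generalizing V with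
  | _ n ih =>
  rw [← LinearMap.range_eq_top, eq_top_iff]
  rcases le_or_gt V.rank N with h | h
  · intro x _
    obtain ⟨e⟩ := nonempty_iso_std_rank V
    let s : Σ n : Fin (N + 1), A.obj (std U n) := ⟨⟨V.rank, Nat.lt_succ_of_le h⟩, act A e.inv x⟩
    refine ⟨act (cover A N) (V := coverObj A N s) e.hom (gen R (coverObj A N) s),
      (freeLift_act_gen (fun s : Σ n : Fin (N + 1), A.obj (std U n) => s.2) s e.hom).trans ?_⟩
    change act A e.hom (act A e.inv x) = x
    rw [act_act]
    simp
  · rw [← hA V h]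
    refine iSup_le fun W => iSup_le fun f => iSup_le fun hW => ?_
    rintro _ ⟨x, rfl⟩
    obtain ⟨y, rfl⟩ := ih W.rank (hn ▸ hW) W rfl x
    exact ⟨act (cover A N) f y, app_act _ f y⟩

theorem epi_coverMap (hA : ∀ V : VICU U, N < V.rank → lowerSpan A V = ⊤) : Epi (coverMap A N) := by
  rw [NatTrans.epi_iff_epi_app]
  exact fun V => (ModuleCat.epi_iff_surjective _).2 (coverMap_surjective hA V)

theorem isZero_of_lowerSpan_eq_top (hA : ∀ V : VICU U, lowerSpan A V = ⊤) : IsZero A := by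
  rw [Functor.isZero_iff]
  intro V
  rw [ModuleCat.isZero_iff_subsingleton, ← Submodule.subsingleton_iff R]
  induction hn : V.rank using Nat.strong_induction_on generalizing V with
  | _ n ih =>
  rw [← subsingleton_iff_bot_eq_top, ← hA V, eq_comm, eq_bot_iff]
  refine iSup_le fun W => iSup_le fun f => iSup_le fun hW => ?_
  rintro _ ⟨x, rfl⟩
  have := (Submodule.subsingleton_iff R).1 (ih W.rank (hn ▸ hW) W rfl)
  rw [Subsingleton.elim x 0, map_zero]
  exact Submodule.zero_mem _

end Cover

/-! ### Homology through a presentation. -/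

section Homology

variable {R : Type v} [CommRing R] {S : ShortComplex (VICU U ⥤ ModuleCat.{max u v} R)}

theorem exact_app {S : ShortComplex (VICU U ⥤ ModuleCat.{max u v} R)} (hS : S.Exact)
    (V : VICU U) : Function.Exact (S.f.app V).hom (S.g.app V).hom :=
  (ShortComplex.ShortExact.moduleCat_exact_iff_function_exact _).1
    (hS.map ((evaluation _ _).obj V))

theorem lowerSpan_le_map_of_surjective {A B : VICU U ⥤ ModuleCat.{max u v} R} (φ : A ⟶ B) [Epi φ]
    (V : VICU U) : lowerSpan B V ≤ (lowerSpan A V).map (φ.app V).hom := by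
  refine iSup_le fun W => iSup_le fun f => iSup_le fun hW => ?_
  rintro _ ⟨x, rfl⟩
  obtain ⟨y, rfl⟩ := app_surjective φ W x
  exact ⟨act A f y, act_mem_lowerSpan A f hW y, app_act φ f y⟩

/-- As the middle term is projective, H_1 of the quotient is the kernel of H_0(X₁) → H_0(X₂); the
condition spells out that this kernel vanishes at V. -/
theorem isZero_homology_one_iff (hS : S.ShortExact) [Projective S.X₂] (V : VICU U) :
    IsZero (((homology U R 1).obj S.X₃).obj V) ↔
      ∀ x : S.X₁.obj V, (S.f.app V).hom x ∈ lowerSpan S.X₂ V → x ∈ lowerSpan S.X₁ V := by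
  let Q := projectiveResolution S.X₁
  let q : Q.complex.X 0 ⟶ S.X₁ := Q.π.f 0
  have hq : Epi q := inferInstanceAs (Epi (Q.π.f 0))
  have hex : Function.Exact ((Q.complex.d 1 0).app V).hom (q.app V).hom :=
    exact_app Q.exact_d_f_zero V
  refine (leftDerived_one_isZero_iff (H0 U R) hS Q ((evaluation _ _).obj V)).trans ?_
  rw [ShortComplex.moduleCat_exact_iff]
  constructor
  · intro h x hx
    obtain ⟨y, rfl⟩ := app_surjective q V x
    obtain ⟨z, hz⟩ := h ((lowerSpan (Q.complex.X 0) V).mkQ y)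
      ((Submodule.Quotient.mk_eq_zero (lowerSpan S.X₂ V)).2 hx)
    obtain ⟨z, rfl⟩ := Submodule.mkQ_surjective (lowerSpan (Q.complex.X 1) V) z
    have hz' : ((Q.complex.d 1 0).app V).hom z - y ∈ lowerSpan (Q.complex.X 0) V :=
      (Submodule.Quotient.eq _).1 hz
    have h1 := lowerSpan_le_comap_app q V hz'
    rw [Submodule.mem_comap, map_sub, hex.apply_apply_eq_zero, zero_sub] at h1
    exact (Submodule.neg_mem_iff _).1 h1
  · intro h y hy
    obtain ⟨y, rfl⟩ := Submodule.mkQ_surjective (lowerSpan (Q.complex.X 0) V) y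
    have h1 : (S.f.app V).hom ((q.app V).hom y) ∈ lowerSpan S.X₂ V :=
      (Submodule.Quotient.mk_eq_zero (lowerSpan S.X₂ V)).1 hy
    obtain ⟨y', hy', hyy'⟩ := lowerSpan_le_map_of_surjective q V (h _ h1)
    obtain ⟨z, hz⟩ := (hex (y - y')).1 (by rw [map_sub, hyy', sub_self])
    refine ⟨(lowerSpan (Q.complex.X 1) V).mkQ z, ?_⟩
    refine (Submodule.Quotient.eq (lowerSpan (Q.complex.X 0) V)).2 ?_
    change ((Q.complex.d 1 0).app V).hom z - y ∈ _
    rw [hz, sub_sub_cancel_left]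
    exact Submodule.neg_mem _ hy'

theorem isZero_homology_succ_iff (hS : S.ShortExact) [Projective S.X₂] (i : ℕ) (V : VICU U) :
    IsZero (((homology U R (i + 2)).obj S.X₃).obj V) ↔
      IsZero (((homology U R (i + 1)).obj S.X₁).obj V) :=
  leftDerived_succ_isZero_iff (H0 U R) hS i ((evaluation _ _).obj V)

end Homology

/-! ### Iterating the syzygy bound. -/

section Vanishing

variable {R : Type v} [CommRing R] (A : VICU U ⥤ ModuleCat.{max u v} R) (N : ℕ)

/-- The kernel of the canonical map from the free cover, as a short complex. -/
noncomputable def coverComplex :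
    ShortComplex (VICU U ⥤ ModuleCat.{max u v} R) :=
  ShortComplex.mk (kernel.ι (coverMap A N)) (coverMap A N) (kernel.condition _)

variable {A} {N}

instance : Projective (coverComplex A N).X₂ := inferInstanceAs (Projective (freeMod R _))

theorem shortExact_coverComplex (hA : ∀ V : VICU U, N < V.rank → lowerSpan A V = ⊤) :
    (coverComplex A N).ShortExact where
  exact := ShortComplex.exact_kernel _
  mono_f := (inferInstance : Mono (kernel.ι (coverMap A N)))
  epi_g := epi_coverMap hA

theorem app_injective {A B : VICU U ⥤ ModuleCat.{max u v} R} (φ : A ⟶ B) [Mono φ] (V : VICU U) :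
    Function.Injective (φ.app V).hom :=
  (ModuleCat.mono_iff_injective _).1 inferInstance

end Vanishing

section Field

variable {R : Type v} [Field R] [CharZero R] [Finite k] {N : ℕ}
  {B : VICU U ⥤ ModuleCat.{max u v} R}

/-- Since `B` embeds in a free module, the kernel of its cover is also the kernel of a map between
free modules. -/
theorem lowerSpan_coverComplex_eq_top {J : Type max u v} {Y : J → VICU U}
    (hY : ∀ j, (Y j).rank ≤ N) (ι : B ⟶ freeMod R Y) [Mono ι]
    (hB : ∀ V : VICU U, N < V.rank → lowerSpan B V = ⊤) {V : VICU U} (hV : 3 * N + 1 < V.rank) :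
    lowerSpan (coverComplex B N).X₁ V = ⊤ := by
  have hS := shortExact_coverComplex hB
  have := hS.mono_f
  exact lowerSpan_eq_top_of_kernel (coverComplex B N).f (coverMap B N ≫ ι)
    (app_injective (coverComplex B N).f)
    (fun W => ((app_injective ι W).comp_exact_iff_exact).2 (exact_app hS.exact W))
    rank_coverObj_le hY hV

theorem isZero_homology_of_submodule (i : ℕ) {J : Type max u v} {Y : J → VICU U}
    (hY : ∀ j, (Y j).rank ≤ N) (ι : B ⟶ freeMod R Y) [Mono ι]
    (hB : ∀ V : VICU U, N < V.rank → lowerSpan B V = ⊤) {V : VICU U}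
    (hV : 3 ^ (i + 1) * (2 * N + 1) < 2 * V.rank + 1) :
    IsZero (((homology U R (i + 1)).obj B).obj V) := by
  induction i generalizing N B J Y with
  | zero =>
    refine (isZero_homology_one_iff (shortExact_coverComplex hB) V).2 fun x _ => ?_
    rw [lowerSpan_coverComplex_eq_top hY ι hB (by omega)]
    trivial
  | succ i ih =>
    have hS := shortExact_coverComplex hB
    let κ : (coverComplex B N).X₁ ⟶ freeMod R (coverObj B N) := (coverComplex B N).f
    have : Mono κ := hS.mono_f
    refine (isZero_homology_succ_iff hS i V).2 ?_
    -- The new bound satisfies 2(3N + 1) + 1 = 3(2N + 1), which accounts for one factor of 3.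
    refine ih (N := 3 * N + 1) (Y := coverObj B N)
      (fun j => (rank_coverObj_le j).trans (by omega)) κ
      (fun W hW => lowerSpan_coverComplex_eq_top hY ι hB hW) ?_
    rw [pow_succ] at hV
    linarith

theorem isZero_homology_of_bounds {A : VICU U ⥤ ModuleCat.{max u v} R}
    (h0 : ∀ V : VICU U, N < V.rank → IsZero (((H0 U R).obj A).obj V))
    (h1 : ∀ V : VICU U, N < V.rank → IsZero (((homology U R 1).obj A).obj V)) (i : ℕ)
    {V : VICU U} (hV : 3 ^ (i + 1) * (2 * N + 1) < 2 * V.rank + 1) :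
    IsZero (((homology U R (i + 2)).obj A).obj V) := by
  have hA (V : VICU U) (hV : N < V.rank) := (isZero_H0_iff A V).1 (h0 V hV)
  have hS := shortExact_coverComplex hA
  let κ : (coverComplex A N).X₁ ⟶ freeMod R (coverObj A N) := (coverComplex A N).f
  have : Mono κ := hS.mono_f
  refine (isZero_homology_succ_iff hS i V).2 ?_
  refine isZero_homology_of_submodule i (Y := coverObj A N) rank_coverObj_le κ
    (fun W hW => ?_) hV
  rw [eq_top_iff]
  intro x _
  -- Above rank N the free cover equals its lower span, so vanishing of H_1 puts every x of the
  -- kernel in the lower span of the kernel.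
  refine (isZero_homology_one_iff hS W).1 (h1 W hW) x ?_
  rw [show lowerSpan (coverComplex A N).X₂ W = ⊤ from lowerSpan_freeMod_eq_top rank_coverObj_le hW]
  trivial

end Field

end VICU

theorem theoremD {k : Type u} [Field k] [Finite k] (U : Subgroup kˣ) {R : Type v} [Field R]
    [CharZero R] (A : VICU U ⥤ ModuleCat.{max u v} R) (d r : ℤ)
    (h0 : ∀ n : ℕ, d < n → IsZero (((VICU.H0 U R).obj A).obj (VICU.std U n)))
    (h1 : ∀ n : ℕ, r < n → IsZero (((VICU.homology U R 1).obj A).obj (VICU.std U n)))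
    (i : ℕ) (hi : 2 ≤ i) (n : ℕ)
    (hn : (n : ℚ) > 3 ^ (i - 1) * (((max r d : ℤ) : ℚ) + 1 / 2) - 1 / 2) :
    IsZero (((VICU.homology U R i).obj A).obj (VICU.std U n)) := by
  obtain ⟨i, rfl⟩ := Nat.exists_eq_add_of_le' hi
  -- With a negative bound H_0 vanishes in every rank, including zero, which forces `A` = 0.
  rcases lt_or_ge (max r d) 0 with hN | hN
  · have hd : d < 0 := (le_max_right r d).trans_lt hN
    have hA : IsZero A := VICU.isZero_of_lowerSpan_eq_top fun V =>
      (VICU.isZero_H0_iff A V).1 ((VICU.isZero_obj_iff_std _ V).2 (h0 _ (by omega)))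
    have := hA.projective
    have h2 : IsZero ((VICU.homology U R (i + 2)).obj A) :=
      (VICU.H0 U R).isZero_leftDerived_obj_projective_succ (i + 1) A
    exact (Functor.isZero_iff _).1 h2 _
  · obtain ⟨N, hN'⟩ := Int.eq_ofNat_of_zero_le hN
    have hr := le_max_left r d
    have hd := le_max_right r d
    refine VICU.isZero_homology_of_bounds (N := N)
      (fun V hV => (VICU.isZero_obj_iff_std _ V).2 (h0 _ (by omega)))
      (fun V hV => (VICU.isZero_obj_iff_std _ V).2 (h1 _ (by omega))) i ?_
    rw [VICU.rank_std]
    rw [hN', show i + 2 - 1 = i + 1 by omega] at hn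
    push_cast at hn
    -- Doubling clears the halves and brings the bound to its integral form.
    have h2 : (3 : ℚ) ^ (i + 1) * (2 * N + 1) < 2 * n + 1 := by linarith
    exact_mod_cast h2
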